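/- For every $d\in\mathbb N$ there is a constant $C>0$, depending only on $d$, such that the following holds. Let $K\in\mathbb N$, $G\in\mathbb R^{K\times d}$, $y\in\mathbb R^K$, let $\Gamma\in\mathbb R^{K\times K}$ and $\Gamma_0\in\mathbb R^{d\times d}$ be symmetric positive definite, and let $\sigma\ge 0$. Put $$\Phi_R(u)=\tfrac12\,|\Gamma^{-1/2}(y-Gu)|^2+\tfrac12\,|\Gamma_0^{-1/2}u|^2,\qquad B=(\Gamma_0^{-1}+G^T\Gamma^{-1}G)^{-1},\qquad u_0=BG^T\Gamma^{-1}y,$$ and, for a probability density $f$ on $\mathbb R^d$ with finite second moment, $$\mathcal M(f)=\int_{\mathbb R^d}u\,f(u)\,du,\qquad \mathcal C(f)=\int_{\mathbb R^d}(u-\mathcal M(f))\otimes(u-\mathcal M(f))\,f(u)\,du .$$ Let $f^1,f^2$ be two Gaussian solutions of the mean-field equation $$\partial_t f=\nabla\cdot\big(\mathcal C(f_t)\,(f\,\nabla\Phi_R+\sigma\nabla f)\big)\qquad\text{on }\mathbb R^d\times[0,\infty),$$ that is, for each $t\ge0$ the function $f^i_t=f^i(\cdot,t)$ is the density of a Gaussian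 with positive definite covariance matrix, $f^i(u,\cdot)$ is continuous on $[0,\infty)$ for each $u$, and the equation holds pointwise for $t>0$. With $|\cdot|$ the Euclidean norm and $|\cdot|_2$ the induced operator norm of matrices, assume that $$|\mathcal C(f^1_0)|_2\vee|\mathcal C(f^2_0)|_2\vee|B|_2\le M,\qquad |\mathcal C(f^1_0)^{-1}|_2\vee|\mathcal C(f^2_0)^{-1}|_2\vee|B^{-1}|_2\le m,\qquad |\mathcal M(f^1_0)-u_0|\le R .$$ Then, for all $t\ge0$, $$W_2(f^1_t,f^2_t)\le C\,\big(1+mM+m^4M^{7/2}R\big)\,\frac{e^{-\sigma t}}{\sqrt{\alpha(t)}^{\,1+\lfloor 1\wedge\sigma\rfloor}}\,W_2(f^1_0,f^2_0),$$ where $W_2$ is the Euclidean Wasserstein distance of order $2$, and $\alpha(t)=2t+1$ if $\sigma=0$, $\alpha(t)=\frac1\sigma(1-e^{-2\sigma t})+e^{-2\sigma t}$ if $\sigma>0$. -/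

import Mathlib

noncomputable section

open MeasureTheory Matrix
open scoped ENNReal MatrixOrder

namespace MeanField

/-- Euclidean space `ℝ^d`, with the euclidean norm. -/
abbrev E (d : ℕ) : Type := EuclideanSpace ℝ (Fin d)

/-- Matrix-vector product as a map between euclidean spaces. -/
def mulE {m n : ℕ} (A : Matrix (Fin m) (Fin n) ℝ) (x : E n) : E m :=
  WithLp.toLp 2 (A *ᵥ x.ofLp)

/-- The operator norm `|A|₂` of a square matrix induced by the euclidean norm. -/
def opNorm {d : ℕ} (A : Matrix (Fin d) (Fin d) ℝ) : ℝ :=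
  ‖Matrix.toEuclideanCLM (n := Fin d) (𝕜 := ℝ) A‖

/-- The weighted norm `|x|_Γ = |Γ^{-1/2} x|`, for a symmetric positive definite matrix `Γ`. -/
def wnorm {n : ℕ} (Γ : Matrix (Fin n) (Fin n) ℝ) (x : E n) : ℝ :=
  ‖mulE (CFC.sqrt Γ)⁻¹ x‖

/-- The data of the linear inverse problem: the forward model `G`, the observation `y` and the
symmetric positive definite matrices `Γ` and `Γ₀`. -/
structure InverseProblem (d K : ℕ) where
  G : Matrix (Fin K) (Fin d) ℝ
  y : E K
  Γ : Matrix (Fin K) (Fin K) ℝ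
  Γ₀ : Matrix (Fin d) (Fin d) ℝ
  posDef_Γ : Γ.PosDef
  posDef_Γ₀ : Γ₀.PosDef

namespace InverseProblem

variable {d K : ℕ} (P : InverseProblem d K)

/-- The regularized least squares functional
`Φ_R(u; y) = |y - G u|_Γ ^ 2 / 2 + |u|_Γ₀ ^ 2 / 2`. -/
def PhiR (u : E d) : ℝ :=
  (1 / 2) * wnorm P.Γ (P.y - mulE P.G u) ^ 2 + (1 / 2) * wnorm P.Γ₀ u ^ 2

/-- The matrix `B = (Γ₀⁻¹ + Gᵀ Γ⁻¹ G)⁻¹`. -/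
def B : Matrix (Fin d) (Fin d) ℝ :=
  (P.Γ₀⁻¹ + P.Gᵀ * P.Γ⁻¹ * P.G)⁻¹

/-- The point `u₀ = B Gᵀ Γ⁻¹ y` (the minimizer of `Φ_R`). -/
def u₀ : E d :=
  mulE (P.B * P.Gᵀ * P.Γ⁻¹) P.y

end InverseProblem

/-- The mean `ℳ(f) = ∫ u f(u) du` of a density `f`. -/
def mean {d : ℕ} (f : E d → ℝ) : E d :=
  ∫ u, f u • u

/-- The covariance matrix `𝒞(f) = ∫ (u - ℳ(f)) ⊗ (u - ℳ(f)) f(u) du` of a density `f`. -/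
def cov {d : ℕ} (f : E d → ℝ) : Matrix (Fin d) (Fin d) ℝ :=
  Matrix.of fun i j => ∫ u, (u i - mean f i) * (u j - mean f j) * f u

/-- The divergence `∇ · V` of a vector field. -/
def divergence {d : ℕ} (V : E d → E d) (u : E d) : ℝ :=
  ∑ i : Fin d, fderiv ℝ (fun v => V v i) u (EuclideanSpace.single i 1)

/-- `f` is a probability density on `ℝ^d` with finite second moment. -/
structure IsDensity {d : ℕ} (f : E d → ℝ) : Prop where
  nonneg : ∀ u, 0 ≤ f u
  integrable : Integrable f
  integral_eq_one : ∫ u, f u = 1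
  secondMoment : Integrable fun u => ‖u‖ ^ 2 * f u

/-- `f t u` is a classical solution of the nonlocal Fokker-Planck equation
`∂ₜ f = ∇ · (𝒞(f_t) (f ∇Φ_R + σ ∇f))` on `ℝ^d × [0, ∞)`: each `f t` is a probability density with
finite second moment, the initial datum `f 0` is attained continuously, and for `t > 0` the
function `f` is twice continuously differentiable in space, differentiable in time, and satisfies
the equation pointwise. Only the values of `f` at times `t ≥ 0` matter. -/
structure IsSolution {d K : ℕ} (P : InverseProblem d K) (σ : ℝ) (f : ℝ → E d → ℝ) : Prop where
  density : ∀ t, 0 ≤ t → IsDensity (f t)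
  continuousOn : ∀ u, ContinuousOn (fun t => f t u) (Set.Ici 0)
  contDiff : ∀ t, 0 < t → ContDiff ℝ 2 (f t)
  equation : ∀ t, 0 < t → ∀ u,
    HasDerivAt (fun s => f s u)
      (divergence
        (fun v => mulE (cov (f t)) (f t v • gradient P.PhiR v + σ • gradient (f t) v)) u) t

/-- The density `g(·; μ, S)` of the nondegenerate Gaussian `𝒩(μ, S)` on `ℝ^d`. -/
def gaussianDensity {d : ℕ} (μ : E d) (S : Matrix (Fin d) (Fin d) ℝ) (u : E d) : ℝ :=
  ((2 * Real.pi) ^ ((d : ℝ) / 2) * √S.det)⁻¹ *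
    Real.exp (-(1 / 2) * inner ℝ (u - μ) (mulE S⁻¹ (u - μ)))

/-- At every time `t ≥ 0`, `f t` is the density of a nondegenerate Gaussian. -/
def IsGaussian {d : ℕ} (f : ℝ → E d → ℝ) : Prop :=
  ∀ t, 0 ≤ t → ∃ (μ : E d) (S : Matrix (Fin d) (Fin d) ℝ), S.PosDef ∧ f t = gaussianDensity μ S

/-- The measure `f(u) du` with density `f`. -/
def toMeasure {d : ℕ} (f : E d → ℝ) : Measure (E d) :=
  volume.withDensity fun u => ENNReal.ofReal (f u)

/-- `π` is a transference plan between `μ` and `ν`. -/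
def IsCoupling {d : ℕ} (π : Measure (E d × E d)) (μ ν : Measure (E d)) : Prop :=
  π.map Prod.fst = μ ∧ π.map Prod.snd = ν

/-- The euclidean Wasserstein distance of order 2, as an extended nonnegative number. -/
def W₂ {d : ℕ} (μ ν : Measure (E d)) : ℝ≥0∞ :=
  (⨅ (π : Measure (E d × E d)) (_ : IsCoupling π μ ν), ∫⁻ p, edist p.1 p.2 ^ 2 ∂π) ^ (1 / 2 : ℝ)

/-- `α(t) = 2 t + 1` if `σ = 0`, and `α(t) = (1 - e^{-2σt}) / σ + e^{-2σt}` if `σ > 0`. -/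
def alpha (σ t : ℝ) : ℝ :=
  if σ = 0 then 2 * t + 1
  else (1 / σ) * (1 - Real.exp (-2 * σ * t)) + Real.exp (-2 * σ * t)

end MeanField

end

noncomputable section

open MeasureTheory Matrix ProbabilityTheory
open scoped ENNReal MatrixOrder Matrix.Norms.L2Operator

namespace MeanField

variable {d k n : ℕ}

/-! For a Gaussian solution with mean `μ` and covariance `S`, dividing the equation by `f` leaves an
identity between quadratic polynomials in `u`. Comparing coefficients shows that `S⁻¹` solves a
linear equation, with solution `e^{-2σt} (S₀⁻¹ + γ B⁻¹)` where `γ = timeChange σ t`. The mean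
decouples in the eigenbasis of `N = B^{-1/2} S₀ B^{-1/2}`: `(1 + γ N)^{1/2} B^{-1/2} (μ - u₀)` is
constant in time (`IsSolution.inv_cov_eq`, `IsSolution.mean_eq`).

The distance is compared with parameters in two different ways. At time `t`, driving both Gaussians
by the same standard normal bounds `W₂` by the differences of the means and of the square roots of
the covariances (`W₂_multivariateGaussian_le`). At time `0`, any coupling of cost `D²` yields `S₁ -
S₂ = √S₁ N₁ + N₂ √S₂` with `N₁`, `N₂` of order `D` (`IsCoupling.exists_cov_sub`). This form is what
square roots require: the Sylvester estimate `norm_le_of_sylvester` turns it into a bound on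
differences of square roots, without a condition number.

Feeding the explicit formulas into these estimates gives the rate `e^{-σt} / α` for the covariances
and `e^{-σt} / √α` for the means (`norm_sqrt_sub_sqrt_le`, `norm_mean_sub_le`). The worse of the two
is the stated rate, since `α ≥ 1` for `σ < 1` and `α ≤ 1` for `σ ≥ 1`. -/

/-! ### Matrix-vector algebra in Euclidean space -/

lemma mulE_eq_toEuclideanCLM (A : Matrix (Fin d) (Fin d) ℝ) (x : E d) :
    mulE A x = toEuclideanCLM (n := Fin d) (𝕜 := ℝ) A x := rfl

lemma opNorm_eq_norm (A : Matrix (Fin d) (Fin d) ℝ) : opNorm A = ‖A‖ := rfl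

lemma opNorm_nonneg (A : Matrix (Fin d) (Fin d) ℝ) : 0 ≤ opNorm A := norm_nonneg _

@[simp] lemma ofLp_mulE (A : Matrix (Fin k) (Fin n) ℝ) (x : E n) :
    (mulE A x).ofLp = A *ᵥ x.ofLp := rfl

lemma mulE_mulE {l : ℕ} (A : Matrix (Fin k) (Fin n) ℝ) (B : Matrix (Fin n) (Fin l) ℝ) (x : E l) :
    mulE A (mulE B x) = mulE (A * B) x := by
  simp [mulE, Matrix.mulVec_mulVec]

@[simp] lemma mulE_one (x : E n) : mulE 1 x = x := by simp [mulE]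

lemma mulE_add (A : Matrix (Fin k) (Fin n) ℝ) (x y : E n) :
    mulE A (x + y) = mulE A x + mulE A y := by
  simp [mulE, Matrix.mulVec_add]

lemma mulE_sub (A : Matrix (Fin k) (Fin n) ℝ) (x y : E n) :
    mulE A (x - y) = mulE A x - mulE A y := by
  simp [mulE, Matrix.mulVec_sub]

lemma mulE_neg (A : Matrix (Fin k) (Fin n) ℝ) (x : E n) : mulE A (-x) = -mulE A x := by
  simp [mulE, Matrix.mulVec_neg]

@[simp] lemma mulE_zero (A : Matrix (Fin k) (Fin n) ℝ) : mulE A 0 = 0 := by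
  simp [mulE]

lemma mulE_smul (A : Matrix (Fin k) (Fin n) ℝ) (r : ℝ) (x : E n) :
    mulE A (r • x) = r • mulE A x := by
  simp [mulE, Matrix.mulVec_smul]

lemma add_mulE (A B : Matrix (Fin k) (Fin n) ℝ) (x : E n) :
    mulE (A + B) x = mulE A x + mulE B x := by
  simp [mulE, Matrix.add_mulVec]

lemma sub_mulE (A B : Matrix (Fin k) (Fin n) ℝ) (x : E n) :
    mulE (A - B) x = mulE A x - mulE B x := by
  simp [mulE, Matrix.sub_mulVec]

lemma smul_mulE (r : ℝ) (A : Matrix (Fin k) (Fin n) ℝ) (x : E n) :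
    mulE (r • A) x = r • mulE A x := by
  simp [mulE, Matrix.smul_mulVec]

lemma norm_mulE_le (A : Matrix (Fin k) (Fin n) ℝ) (x : E n) : ‖mulE A x‖ ≤ ‖A‖ * ‖x‖ :=
  Matrix.l2_opNorm_mulVec A x

lemma inner_mulE_right (A : Matrix (Fin k) (Fin n) ℝ) (x : E k) (y : E n) :
    inner ℝ x (mulE A y) = inner ℝ (mulE Aᵀ x) y := by
  simp only [EuclideanSpace.inner_eq_star_dotProduct, ofLp_mulE, star_trivial]
  rw [Matrix.mulVec_transpose, dotProduct_comm, Matrix.dotProduct_mulVec, dotProduct_comm]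

lemma inner_mulE_symm {A : Matrix (Fin n) (Fin n) ℝ} (hA : A.IsHermitian) (x y : E n) :
    inner ℝ x (mulE A y) = inner ℝ (mulE A x) y := by
  rw [inner_mulE_right, show Aᵀ = A by simpa using hA.eq]

lemma norm_le_of_mulE_le {A : Matrix (Fin d) (Fin d) ℝ} {r : ℝ} (hr : 0 ≤ r)
    (h : ∀ x : E d, ‖mulE A x‖ ≤ r * ‖x‖) : ‖A‖ ≤ r :=
  ContinuousLinearMap.opNorm_le_bound _ hr h

lemma norm_transpose (A : Matrix (Fin d) (Fin d) ℝ) : ‖Aᵀ‖ = ‖A‖ := by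
  simpa using l2_opNorm_conjTranspose A

lemma matrix_ext_mulE {A B : Matrix (Fin k) (Fin n) ℝ} (h : ∀ x, mulE A x = mulE B x) : A = B := by
  apply Matrix.ext_of_mulVec_single
  intro i
  simpa [mulE] using congrArg WithLp.ofLp (h (WithLp.toLp 2 (Pi.single i 1)))

/-- A symmetric matrix is determined by its quadratic form. -/
lemma isHermitian_ext {A B : Matrix (Fin n) (Fin n) ℝ} (hA : A.IsHermitian) (hB : B.IsHermitian)
    (h : ∀ x : E n, inner ℝ x (mulE A x) = inner ℝ x (mulE B x)) : A = B := by
  apply matrix_ext_mulE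
  intro x
  refine ext_inner_left ℝ fun y => ?_
  have h1 := h (x + y)
  have h2 := h x
  have h3 := h y
  simp only [mulE_add, inner_add_left, inner_add_right] at h1
  have e1 : inner ℝ x (mulE A y) = inner ℝ y (mulE A x) := by
    rw [inner_mulE_symm hA, real_inner_comm]
  have e2 : inner ℝ x (mulE B y) = inner ℝ y (mulE B x) := by
    rw [inner_mulE_symm hB, real_inner_comm]
  linarith

/-! ### Positive definite matrices -/

lemma posDef_mul_inv {A : Matrix (Fin n) (Fin n) ℝ} (hA : A.PosDef) : A * A⁻¹ = 1 :=
  Matrix.mul_nonsing_inv _ ((Matrix.isUnit_iff_isUnit_det _).1 hA.isUnit)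

lemma posDef_inv_mul {A : Matrix (Fin n) (Fin n) ℝ} (hA : A.PosDef) : A⁻¹ * A = 1 :=
  Matrix.nonsing_inv_mul _ ((Matrix.isUnit_iff_isUnit_det _).1 hA.isUnit)

lemma posDef_sqrt {A : Matrix (Fin n) (Fin n) ℝ} (hA : A.PosDef) : (CFC.sqrt A).PosDef := by
  have h0 : (CFC.sqrt A).PosSemidef := nonneg_iff_posSemidef.1 (CFC.sqrt_nonneg A)
  rw [h0.posDef_iff_isUnit, CFC.isUnit_sqrt_iff A hA.posSemidef.nonneg]
  exact hA.isUnit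

lemma sqrt_mul_sqrt {A : Matrix (Fin n) (Fin n) ℝ} (hA : A.PosDef) :
    CFC.sqrt A * CFC.sqrt A = A :=
  CFC.sqrt_mul_sqrt_self _ hA.posSemidef.nonneg

lemma inv_sqrt_mul_inv_sqrt {A : Matrix (Fin n) (Fin n) ℝ} (hA : A.PosDef) :
    (CFC.sqrt A)⁻¹ * (CFC.sqrt A)⁻¹ = A⁻¹ := by
  rw [← Matrix.mul_inv_rev, sqrt_mul_sqrt hA]

lemma inner_mulE_nonneg {A : Matrix (Fin n) (Fin n) ℝ} (hA : A.PosDef) (x : E n) :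
    0 ≤ inner ℝ x (mulE A x) := by
  simpa [EuclideanSpace.inner_eq_star_dotProduct, dotProduct_comm] using
    hA.posSemidef.dotProduct_mulVec_nonneg x.ofLp

lemma inner_mulE_eq_norm_sqrt {A : Matrix (Fin n) (Fin n) ℝ} (hA : A.PosDef) (x : E n) :
    inner ℝ x (mulE A x) = ‖mulE (CFC.sqrt A) x‖ ^ 2 := by
  conv_lhs => rw [← sqrt_mul_sqrt hA, ← mulE_mulE, inner_mulE_symm (posDef_sqrt hA).isHermitian]
  rw [real_inner_self_eq_norm_sq]

lemma norm_sq_le_of_norm_inv_le {A : Matrix (Fin n) (Fin n) ℝ} (hA : A.PosDef) {m : ℝ}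
    (hm : ‖A⁻¹‖ ≤ m) (x : E n) : ‖x‖ ^ 2 ≤ m * inner ℝ x (mulE A x) := by
  have hs := posDef_sqrt hA
  rw [inner_mulE_eq_norm_sqrt hA]
  set y := mulE (CFC.sqrt A) x
  have hx : x = mulE (CFC.sqrt A)⁻¹ y := by
    rw [mulE_mulE, posDef_inv_mul hs, mulE_one]
  have h1 : ‖x‖ ^ 2 = inner ℝ y (mulE A⁻¹ y) := by
    rw [← inv_sqrt_mul_inv_sqrt hA, ← mulE_mulE, inner_mulE_symm hs.inv.isHermitian, ← hx,
      real_inner_self_eq_norm_sq]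
  rw [h1]
  calc inner ℝ y (mulE A⁻¹ y) ≤ ‖y‖ * ‖mulE A⁻¹ y‖ := real_inner_le_norm _ _
    _ ≤ ‖y‖ * (m * ‖y‖) := by
        gcongr
        exact (norm_mulE_le _ _).trans (by gcongr)
    _ = m * ‖y‖ ^ 2 := by ring

lemma norm_inv_le_of_le_inner {A : Matrix (Fin n) (Fin n) ℝ} (hA : A.PosDef) {c : ℝ} (hc : 0 < c)
    (h : ∀ x : E n, c * ‖x‖ ^ 2 ≤ inner ℝ x (mulE A x)) : ‖A⁻¹‖ ≤ 1 / c := by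
  refine norm_le_of_mulE_le (by positivity) fun y => ?_
  have h1 := h (mulE A⁻¹ y)
  rw [mulE_mulE, posDef_mul_inv hA, mulE_one] at h1
  have h2 := h1.trans (real_inner_le_norm _ _)
  rcases (norm_nonneg (mulE A⁻¹ y)).eq_or_lt with h0 | h0
  · rw [← h0]; positivity
  · have : c * ‖mulE A⁻¹ y‖ ≤ ‖y‖ := by
      refine le_of_mul_le_mul_left ?_ h0
      linarith
    rw [div_mul_eq_mul_div, one_mul, le_div_iff₀ hc]
    linarith

/-! ### Entries and norms; a Sylvester estimate -/

lemma abs_apply_le_norm (A : Matrix (Fin d) (Fin d) ℝ) (i j : Fin d) : |A i j| ≤ ‖A‖ := by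
  have h1 := norm_mulE_le A (EuclideanSpace.single j 1)
  have h2 : ‖(mulE A (EuclideanSpace.single j 1)) i‖ ≤ ‖mulE A (EuclideanSpace.single j 1)‖ :=
    PiLp.norm_apply_le _ i
  simpa using h2.trans h1

lemma norm_le_of_abs_apply_le {A : Matrix (Fin d) (Fin d) ℝ} {r : ℝ} (h : ∀ i j, |A i j| ≤ r) :
    ‖A‖ ≤ (d : ℝ) ^ 2 * r := by
  have hs : ∀ (i j : Fin d) (c : ℝ), ‖Matrix.single i j c‖ ≤ |c| := by
    intro i j c
    refine norm_le_of_mulE_le (abs_nonneg c) fun x => ?_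
    have : mulE (Matrix.single i j c) x = EuclideanSpace.single i (c * x j) := by
      ext l
      simp [mulE, Matrix.single_mulVec, Function.update_apply]
    rw [this, PiLp.norm_single, norm_mul, Real.norm_eq_abs]
    gcongr
    exact PiLp.norm_apply_le _ j
  rw [Matrix.matrix_eq_sum_single A]
  calc ‖∑ i, ∑ j, Matrix.single i j (A i j)‖
      ≤ ∑ i : Fin d, ∑ j : Fin d, r :=
        norm_sum_le_of_le _ fun i _ => norm_sum_le_of_le _ fun j _ => (hs i j _).trans (h i j)
    _ = (d : ℝ) ^ 2 * r := by simp; ring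

lemma exists_diagonalization {A : Matrix (Fin d) (Fin d) ℝ} (hA : A.PosDef) :
    ∃ U : Matrix (Fin d) (Fin d) ℝ, ∃ a : Fin d → ℝ, U * Uᵀ = 1 ∧ Uᵀ * U = 1 ∧
      (∀ i, 0 < a i) ∧ A = U * diagonal a * Uᵀ := by
  have hstar : ∀ U : Matrix (Fin d) (Fin d) ℝ, star U = Uᵀ := fun U => by
    rw [star_eq_conjTranspose, conjTranspose_eq_transpose_of_trivial]
  refine ⟨hA.isHermitian.eigenvectorUnitary, hA.isHermitian.eigenvalues, ?_, ?_,
    hA.eigenvalues_pos, ?_⟩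
  · rw [← hstar]; exact Unitary.coe_mul_star_self hA.isHermitian.eigenvectorUnitary
  · rw [← hstar]; exact Unitary.coe_star_mul_self hA.isHermitian.eigenvectorUnitary
  · rw [← hstar]; simpa [Unitary.conjStarAlgAut_apply] using hA.isHermitian.spectral_theorem

lemma norm_le_one_of_transpose_mul_self {U : Matrix (Fin d) (Fin d) ℝ} (h : Uᵀ * U = 1) :
    ‖U‖ ≤ 1 := by
  refine norm_le_of_mulE_le zero_le_one fun x => ?_
  have : ‖mulE U x‖ ^ 2 = ‖x‖ ^ 2 := by
    rw [← real_inner_self_eq_norm_sq, inner_mulE_right, mulE_mulE, h, mulE_one,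
      real_inner_self_eq_norm_sq]
  rw [one_mul]
  exact (pow_le_pow_iff_left₀ (norm_nonneg _) (norm_nonneg _) two_ne_zero).1 this.le

/-- In eigenbases of `a` and `b` the equation decouples into scalar ones, each entry of `Q` being a
weighted average of the entries of `P` and `P'`. Hence the bound does not depend on the spectra of
`a` and `b`; the factor `d ^ 2` only pays for passing from entries to the operator norm. -/
lemma norm_le_of_sylvester {a b Q P P' : Matrix (Fin d) (Fin d) ℝ} (ha : a.PosDef) (hb : b.PosDef)
    (h : a * Q + Q * b = a * P + P' * b) : ‖Q‖ ≤ (d : ℝ) ^ 2 * (‖P‖ + ‖P'‖) := by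
  obtain ⟨U, α, hU, hU', hα, rfl⟩ := exists_diagonalization ha
  obtain ⟨V, β, hV, hV', hβ, rfl⟩ := exists_diagonalization hb
  have nU := norm_le_one_of_transpose_mul_self hU'
  have nV := norm_le_one_of_transpose_mul_self hV'
  have nU' : ‖Uᵀ‖ ≤ 1 := by rwa [norm_transpose]
  have nV' : ‖Vᵀ‖ ≤ 1 := by rwa [norm_transpose]
  have bound : ∀ X Y Z : Matrix (Fin d) (Fin d) ℝ, ‖X‖ ≤ 1 → ‖Z‖ ≤ 1 → ‖X * Y * Z‖ ≤ ‖Y‖ := by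
    intro X Y Z hX hZ
    calc ‖X * Y * Z‖ ≤ ‖X‖ * ‖Y‖ * ‖Z‖ := (norm_mul_le _ _).trans (by gcongr; exact norm_mul_le _ _)
      _ ≤ 1 * ‖Y‖ * 1 := by gcongr
      _ = ‖Y‖ := by ring
  have key : diagonal α * (Uᵀ * Q * V) + (Uᵀ * Q * V) * diagonal β =
      diagonal α * (Uᵀ * P * V) + (Uᵀ * P' * V) * diagonal β := by
    have h2 := congrArg (fun X => Uᵀ * X * V) h
    simp only [mul_add, add_mul] at h2
    have e1 : ∀ X : Matrix (Fin d) (Fin d) ℝ,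
        Uᵀ * (U * diagonal α * Uᵀ * X) * V = diagonal α * (Uᵀ * X * V) := by
      intro X
      calc _ = (Uᵀ * U) * diagonal α * (Uᵀ * X * V) := by simp only [mul_assoc]
        _ = _ := by rw [hU', one_mul]
    have e2 : ∀ X : Matrix (Fin d) (Fin d) ℝ,
        Uᵀ * (X * (V * diagonal β * Vᵀ)) * V = (Uᵀ * X * V) * diagonal β := by
      intro X
      calc _ = (Uᵀ * X * V) * diagonal β * (Vᵀ * V) := by simp only [mul_assoc]
        _ = _ := by rw [hV', mul_one]
    simpa only [e1, e2] using h2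
  have hQ : Q = U * (Uᵀ * Q * V) * Vᵀ := by
    calc Q = (U * Uᵀ) * Q * (V * Vᵀ) := by rw [hU, hV, one_mul, mul_one]
      _ = _ := by simp only [mul_assoc]
  calc ‖Q‖ = ‖U * (Uᵀ * Q * V) * Vᵀ‖ := by rw [← hQ]
    _ ≤ ‖Uᵀ * Q * V‖ := bound _ _ _ nU nV'
    _ ≤ _ := norm_le_of_abs_apply_le fun i j => ?_
  have hij := congrFun (congrFun key i) j
  simp only [Matrix.add_apply, Matrix.diagonal_mul, Matrix.mul_diagonal] at hij
  have b1 := (abs_apply_le_norm (Uᵀ * P * V) i j).trans (bound _ _ _ nU' nV)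
  have b2 := (abs_apply_le_norm (Uᵀ * P' * V) i j).trans (bound _ _ _ nU' nV)
  generalize (Uᵀ * Q * V) i j = q at *
  generalize (Uᵀ * P * V) i j = p at *
  generalize (Uᵀ * P' * V) i j = p' at *
  have hp := hα i
  have hp' := hβ j
  have hs : 0 < α i + β j := by linarith
  have e : q = (α i * p + p' * β j) / (α i + β j) := by
    rw [eq_div_iff hs.ne']; linarith
  rw [e, abs_div, abs_of_pos hs, div_le_iff₀ hs]
  calc |α i * p + p' * β j| ≤ α i * |p| + |p'| * β j := by
        refine (abs_add_le _ _).trans ?_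
        rw [abs_mul, abs_mul, abs_of_pos hp, abs_of_pos hp']
    _ ≤ α i * ‖P‖ + ‖P'‖ * β j := by gcongr
    _ ≤ (‖P‖ + ‖P'‖) * (α i + β j) := by
        nlinarith [norm_nonneg P, norm_nonneg P']

/-! ### Identification of `gaussianDensity` with `multivariateGaussian` -/

lemma continuous_mulE (A : Matrix (Fin k) (Fin n) ℝ) : Continuous (mulE A) :=
  (Matrix.toEuclideanLin A).continuous_of_finiteDimensional

lemma gaussianDensity_pos (μ : E d) {S : Matrix (Fin d) (Fin d) ℝ} (hS : S.PosDef) (u : E d) :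
    0 < gaussianDensity μ S u := by
  have := hS.det_pos
  unfold gaussianDensity
  positivity

lemma continuous_gaussianDensity (μ : E d) (S : Matrix (Fin d) (Fin d) ℝ) :
    Continuous (gaussianDensity μ S) := by
  have := continuous_mulE S⁻¹
  unfold gaussianDensity
  fun_prop

lemma gaussianDensity_zero_one (u : E d) :
    gaussianDensity 0 1 u = ((2 * Real.pi) ^ ((d : ℝ) / 2))⁻¹ * Real.exp (-(1 / 2) * ‖u‖ ^ 2) := by
  simp [gaussianDensity]

lemma charFun_toMeasure_gaussianDensity_zero_one (t : E d) :
    charFun (toMeasure (gaussianDensity (0 : E d) 1)) t = Complex.exp (-‖t‖ ^ 2 / 2) := by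
  have hm : Measurable fun u : E d => ENNReal.ofReal (gaussianDensity 0 1 u) :=
    (continuous_gaussianDensity _ _).measurable.ennreal_ofReal
  rw [charFun_apply, toMeasure, integral_withDensity_eq_integral_toReal_smul hm (by simp)]
  have h := GaussianFourier.integral_cexp_neg_mul_sq_norm_add (V := E d) (b := (1 / 2 : ℂ))
    (by norm_num) Complex.I t
  have e : ∀ u : E d, (ENNReal.ofReal (gaussianDensity 0 1 u)).toReal •
      Complex.exp (inner ℝ u t * Complex.I) = (((2 * Real.pi) ^ ((d : ℝ) / 2) : ℝ) : ℂ)⁻¹ *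
        Complex.exp (-(1 / 2) * ‖u‖ ^ 2 + Complex.I * inner ℝ t u) := by
    intro u
    rw [ENNReal.toReal_ofReal (gaussianDensity_pos _ PosDef.one _).le, gaussianDensity_zero_one,
      Complex.real_smul, Complex.exp_add, real_inner_comm]
    push_cast
    rw [mul_comm Complex.I]
    ring
  simp_rw [e]
  rw [integral_const_mul, h]
  have h2 : ((Real.pi : ℂ) / (1 / 2)) ^ ((Module.finrank ℝ (E d) : ℂ) / 2) =
      (((2 * Real.pi) ^ ((d : ℝ) / 2) : ℝ) : ℂ) := by
    rw [Complex.ofReal_cpow (by positivity)]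
    simp
    ring_nf
  have h3 : (((2 * Real.pi) ^ ((d : ℝ) / 2) : ℝ) : ℂ) ≠ 0 := by
    norm_cast
    positivity
  rw [h2, ← mul_assoc, inv_mul_cancel₀ h3, one_mul, Complex.I_sq]
  congr 1
  ring

lemma toMeasure_gaussianDensity_zero_one :
    toMeasure (gaussianDensity (0 : E d) 1) = stdGaussian (E d) := by
  have hi : Integrable (gaussianDensity (0 : E d) 1) := by
    have h := (GaussianFourier.integrable_cexp_neg_mul_sq_norm_add (V := E d) (b := (1 / 2 : ℂ))
      (by norm_num) 0 0).norm.const_mul ((2 * Real.pi) ^ ((d : ℝ) / 2))⁻¹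
    refine h.congr (Filter.Eventually.of_forall fun u => ?_)
    simp only [gaussianDensity_zero_one, Complex.norm_exp]
    congr 2
    norm_num
    norm_cast
  have : IsFiniteMeasure (toMeasure (gaussianDensity (0 : E d) 1)) :=
    isFiniteMeasure_withDensity_ofReal hi.2
  refine Measure.ext_of_charFun ?_
  ext t
  rw [charFun_toMeasure_gaussianDensity_zero_one, charFun_stdGaussian]

lemma map_affine_volume (μ : E d) {A : Matrix (Fin d) (Fin d) ℝ} (hA : A.det ≠ 0) :
    Measure.map (fun x => μ + mulE A x) (volume : Measure (E d)) =
      ENNReal.ofReal |A.det⁻¹| • volume := by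
  have hdet : LinearMap.det (Matrix.toEuclideanLin A) = A.det := by
    rw [Matrix.toEuclideanLin_eq_toLin_orthonormal, LinearMap.det_toLin]
  have h1 := Measure.map_linearMap_addHaar_eq_smul_addHaar (volume : Measure (E d))
    (f := Matrix.toEuclideanLin A) (by rwa [hdet])
  have h2 : (fun x => μ + mulE A x) = (fun x => μ + x) ∘ (Matrix.toEuclideanLin A) := rfl
  rw [h2, ← Measure.map_map (f := ⇑(Matrix.toEuclideanLin A)) (measurable_const_add μ)
    (continuous_mulE A).measurable, h1, hdet,
    Measure.map_smul, (measurePreserving_add_left volume μ).map_eq]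

/-- `multivariateGaussian` is the image of `stdGaussian` under `x ↦ μ + √S x`, so the standard case,
settled by characteristic functions, and the change of variables with Jacobian `det √S = √(det S)`
suffice. -/
lemma toMeasure_gaussianDensity (μ : E d) {S : Matrix (Fin d) (Fin d) ℝ} (hS : S.PosDef) :
    toMeasure (gaussianDensity μ S) = multivariateGaussian μ S := by
  have hs := posDef_sqrt hS
  have hsd := hs.det_pos
  have hdet : (CFC.sqrt S).det = √S.det := by
    simpa using hS.posSemidef.det_sqrt
  have hφ : Measurable fun x : E d => μ + mulE (CFC.sqrt S) x :=
    ((continuous_mulE _).measurable.const_add μ)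
  have hg : ∀ x, gaussianDensity 0 1 x =
      (CFC.sqrt S).det * gaussianDensity μ S (μ + mulE (CFC.sqrt S) x) := by
    intro x
    have e : inner ℝ (mulE (CFC.sqrt S) x) (mulE S⁻¹ (mulE (CFC.sqrt S) x)) = ‖x‖ ^ 2 := by
      rw [← inv_sqrt_mul_inv_sqrt hS, ← mulE_mulE, mulE_mulE _ (CFC.sqrt S), posDef_inv_mul hs,
        mulE_one, inner_mulE_symm hs.inv.isHermitian, mulE_mulE, posDef_inv_mul hs, mulE_one,
        real_inner_self_eq_norm_sq]
    rw [gaussianDensity_zero_one, gaussianDensity, add_sub_cancel_left, e, ← hdet]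
    field_simp
  rw [multivariateGaussian, ← toMeasure_gaussianDensity_zero_one]
  change _ = Measure.map (fun x => μ + mulE (CFC.sqrt S) x) _
  ext s hs'
  rw [Measure.map_apply hφ hs', toMeasure, toMeasure, withDensity_apply _ hs',
    withDensity_apply _ (hφ hs'), ← lintegral_indicator hs', ← lintegral_indicator (hφ hs')]
  have hm : Measurable (s.indicator fun u => ENNReal.ofReal (gaussianDensity μ S u)) :=
    ((continuous_gaussianDensity _ _).measurable.ennreal_ofReal).indicator hs'
  have h1 := lintegral_map (μ := (volume : Measure (E d))) hm hφ
  rw [map_affine_volume μ hsd.ne', lintegral_smul_measure] at h1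
  have h2 : ∀ x, ((fun x : E d => μ + mulE (CFC.sqrt S) x) ⁻¹' s).indicator
      (fun a => ENNReal.ofReal (gaussianDensity 0 1 a)) x = ENNReal.ofReal (CFC.sqrt S).det *
      s.indicator (fun u => ENNReal.ofReal (gaussianDensity μ S u)) (μ + mulE (CFC.sqrt S) x) := by
    intro x
    by_cases hx : μ + mulE (CFC.sqrt S) x ∈ s
    · rw [Set.indicator_of_mem hx, Set.indicator_of_mem (by exact hx), hg,
        ENNReal.ofReal_mul hsd.le]
    · rw [Set.indicator_of_notMem hx, Set.indicator_of_notMem (by exact hx), mul_zero]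
  simp_rw [h2]
  rw [lintegral_const_mul _ (f := fun x => s.indicator (fun u => ENNReal.ofReal
    (gaussianDensity μ S u)) (μ + mulE (CFC.sqrt S) x)) (hm.comp hφ), ← h1, smul_eq_mul, ← mul_assoc,
    ← ENNReal.ofReal_mul hsd.le, abs_of_pos (inv_pos.2 hsd), mul_inv_cancel₀ hsd.ne']
  simp

lemma integral_toMeasure_gaussianDensity {F : Type*} [NormedAddCommGroup F] [NormedSpace ℝ F]
    (μ : E d) {S : Matrix (Fin d) (Fin d) ℝ} (hS : S.PosDef) (g : E d → F) :
    ∫ u, g u ∂(multivariateGaussian μ S) = ∫ u, gaussianDensity μ S u • g u := by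
  have hm : Measurable fun u : E d => ENNReal.ofReal (gaussianDensity μ S u) :=
    (continuous_gaussianDensity _ _).measurable.ennreal_ofReal
  rw [← toMeasure_gaussianDensity μ hS, toMeasure,
    integral_withDensity_eq_integral_toReal_smul hm (by simp)]
  simp_rw [ENNReal.toReal_ofReal (gaussianDensity_pos μ hS _).le]

lemma mean_gaussianDensity (μ : E d) {S : Matrix (Fin d) (Fin d) ℝ} (hS : S.PosDef) :
    mean (gaussianDensity μ S) = μ := by
  rw [mean, ← integral_toMeasure_gaussianDensity μ hS (fun u => u),
    integral_id_multivariateGaussian]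

lemma cov_gaussianDensity (μ : E d) {S : Matrix (Fin d) (Fin d) ℝ} (hS : S.PosDef) :
    cov (gaussianDensity μ S) = S := by
  ext i j
  have hmean : ∀ i, ∫ x : E d, x i ∂(multivariateGaussian μ S) = μ i := by
    intro i
    have h := ContinuousLinearMap.integral_comp_comm (EuclideanSpace.proj (𝕜 := ℝ) i)
      (IsGaussian.integrable_fun_id (μ := multivariateGaussian μ S))
    simpa using h
  rw [← covariance_eval_multivariateGaussian (μ := μ) hS.posSemidef i j, covariance, hmean, hmean,
    integral_toMeasure_gaussianDensity μ hS, cov, Matrix.of_apply, mean_gaussianDensity μ hS]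
  simp_rw [smul_eq_mul, mul_comm]

/-! ### Upper bound for the Wasserstein distance of two Gaussians -/

/-- A dimensional constant for the comparison of the Wasserstein distance of Gaussians with the
distance of their parameters. -/
def gaussConst (d : ℕ) : ℝ := 2 * (1 + ∫ x : E d, ‖x‖ ^ 2 ∂(stdGaussian (E d)))

lemma integral_norm_sq_stdGaussian_nonneg : 0 ≤ ∫ x : E d, ‖x‖ ^ 2 ∂(stdGaussian (E d)) :=
  integral_nonneg fun _ => by positivity

lemma gaussConst_pos (d : ℕ) : 0 < gaussConst d := by
  have := integral_norm_sq_stdGaussian_nonneg (d := d)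
  unfold gaussConst
  positivity

/-- The coupling transports the same standard normal `x` to `μ₁ + √S₁ x` and `μ₂ + √S₂ x`. It need
not be optimal, but its cost is controlled up to a dimensional constant. -/
lemma W₂_multivariateGaussian_le (μ₁ μ₂ : E d) (S₁ S₂ : Matrix (Fin d) (Fin d) ℝ) :
    W₂ (multivariateGaussian μ₁ S₁) (multivariateGaussian μ₂ S₂) ≤
      ENNReal.ofReal (gaussConst d * (‖μ₁ - μ₂‖ + ‖CFC.sqrt S₁ - CFC.sqrt S₂‖)) := by
  set a := CFC.sqrt S₁
  set b := CFC.sqrt S₂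
  have h₁ : Measurable fun x : E d => μ₁ + mulE a x := (continuous_mulE a).measurable.const_add μ₁
  have h₂ : Measurable fun x : E d => μ₂ + mulE b x := (continuous_mulE b).measurable.const_add μ₂
  set π := (stdGaussian (E d)).map fun x => (μ₁ + mulE a x, μ₂ + mulE b x)
  have hπ : IsCoupling π (multivariateGaussian μ₁ S₁) (multivariateGaussian μ₂ S₂) := by
    constructor
    · rw [Measure.map_map measurable_fst (h₁.prodMk h₂)]; rfl
    · rw [Measure.map_map measurable_snd (h₁.prodMk h₂)]; rfl
  have hc := integral_norm_sq_stdGaussian_nonneg (d := d)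
  set c := ∫ x : E d, ‖x‖ ^ 2 ∂(stdGaussian (E d)) with hcdef
  have hint : Integrable (fun x : E d => ‖x‖ ^ 2) (stdGaussian (E d)) :=
    (IsGaussian.memLp_two_id (μ := stdGaussian (E d))).integrable_norm_pow two_ne_zero
  have hcost : ∫⁻ p, edist p.1 p.2 ^ 2 ∂π ≤
      ENNReal.ofReal ((gaussConst d * (‖μ₁ - μ₂‖ + ‖a - b‖)) ^ 2) := by
    rw [lintegral_map (by fun_prop) (h₁.prodMk h₂)]
    have hpt : ∀ x : E d, edist (μ₁ + mulE a x) (μ₂ + mulE b x) ^ 2 ≤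
        ENNReal.ofReal (2 * ‖μ₁ - μ₂‖ ^ 2 + 2 * ‖a - b‖ ^ 2 * ‖x‖ ^ 2) := by
      intro x
      rw [edist_dist, ← ENNReal.ofReal_pow dist_nonneg]
      apply ENNReal.ofReal_le_ofReal
      have e : μ₁ + mulE a x - (μ₂ + mulE b x) = (μ₁ - μ₂) + mulE (a - b) x := by
        rw [sub_mulE]; abel
      have h := norm_add_le (μ₁ - μ₂) (mulE (a - b) x)
      have h' := norm_mulE_le (a - b) x
      rw [dist_eq_norm, e]
      calc ‖(μ₁ - μ₂) + mulE (a - b) x‖ ^ 2 ≤ (‖μ₁ - μ₂‖ + ‖a - b‖ * ‖x‖) ^ 2 := by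
            gcongr; linarith
        _ ≤ _ := by nlinarith [sq_nonneg (‖μ₁ - μ₂‖ - ‖a - b‖ * ‖x‖)]
    calc ∫⁻ x, edist (μ₁ + mulE a x) (μ₂ + mulE b x) ^ 2 ∂(stdGaussian (E d))
        ≤ ∫⁻ x, ENNReal.ofReal (2 * ‖μ₁ - μ₂‖ ^ 2 + 2 * ‖a - b‖ ^ 2 * ‖x‖ ^ 2)
            ∂(stdGaussian (E d)) := lintegral_mono hpt
      _ = ENNReal.ofReal (2 * ‖μ₁ - μ₂‖ ^ 2 + 2 * ‖a - b‖ ^ 2 * c) := by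
          have hi : Integrable (fun x : E d => 2 * ‖μ₁ - μ₂‖ ^ 2 + 2 * ‖a - b‖ ^ 2 * ‖x‖ ^ 2)
              (stdGaussian (E d)) := (integrable_const _).add (hint.const_mul _)
          rw [← ofReal_integral_eq_lintegral_ofReal hi
            (Filter.Eventually.of_forall fun x => by positivity),
            integral_add (integrable_const _) (hint.const_mul _)]
          simp [hcdef, integral_const_mul]
      _ ≤ _ := by
          apply ENNReal.ofReal_le_ofReal
          have : gaussConst d = 2 * (1 + c) := rfl
          rw [this]
          have h1 := norm_nonneg (μ₁ - μ₂)
          have h2 := norm_nonneg (a - b)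
          generalize ‖μ₁ - μ₂‖ = p at *
          generalize ‖a - b‖ = q at *
          have e : (2 * (1 + c) * (p + q)) ^ 2 = 4 * (1 + 2 * c + c ^ 2) * (p ^ 2 + 2 * p * q + q ^ 2) := by
            ring
          rw [e]
          have : 0 ≤ p * q := by positivity
          have : 0 ≤ c * p ^ 2 := by positivity
          have : 0 ≤ c * q ^ 2 := by positivity
          have : 0 ≤ c * (p * q) := by positivity
          have : 0 ≤ c ^ 2 * (p ^ 2 + 2 * p * q + q ^ 2) := by positivity
          nlinarith [sq_nonneg p, sq_nonneg q]
  calc W₂ _ _ ≤ (∫⁻ p, edist p.1 p.2 ^ 2 ∂π) ^ (1 / 2 : ℝ) := by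
        unfold W₂
        gcongr
        exact iInf₂_le π hπ
    _ ≤ (ENNReal.ofReal ((gaussConst d * (‖μ₁ - μ₂‖ + ‖a - b‖)) ^ 2)) ^ (1 / 2 : ℝ) := by
        gcongr
    _ = _ := by
        have := gaussConst_pos d
        rw [ENNReal.ofReal_rpow_of_nonneg (by positivity) (by norm_num), ← Real.sqrt_eq_rpow,
          Real.sqrt_sq (by positivity)]

/-! ### Lower bound for the cost of a coupling of two Gaussians -/

/-- Cauchy–Schwarz, from the nonnegative variance of `Y - cov[X, Y] X`. -/
lemma covariance_sq_le_variance {Ω : Type*} [MeasurableSpace Ω] {π : Measure Ω}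
    [IsProbabilityMeasure π] {X Y : Ω → ℝ} (hX : MemLp X 2 π) (hY : MemLp Y 2 π)
    (h1 : cov[X, X; π] = 1) : cov[X, Y; π] ^ 2 ≤ cov[Y, Y; π] := by
  set c := cov[X, Y; π] with hc
  have h := variance_nonneg (Y - c • X) π
  rw [← covariance_self (hY.sub (hX.const_smul c)).aemeasurable,
    covariance_sub_sub hY (hX.const_smul c) hY (hX.const_smul c)] at h
  simp only [covariance_smul_left, covariance_smul_right, covariance_comm Y X, h1, ← hc] at h
  nlinarith

/-- The transport cost of a coupling of two Gaussians controls the difference of the means, and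
the difference of the covariance matrices in a form adapted to their square roots. -/
lemma IsCoupling.exists_cov_sub {π : Measure (E d × E d)} {μ₁ μ₂ : E d}
    {S₁ S₂ : Matrix (Fin d) (Fin d) ℝ} (hS₁ : S₁.PosDef) (hS₂ : S₂.PosDef)
    (hπ : IsCoupling π (multivariateGaussian μ₁ S₁) (multivariateGaussian μ₂ S₂)) :
    ∃ D : ℝ, 0 ≤ D ∧ ∫⁻ p, edist p.1 p.2 ^ 2 ∂π = ENNReal.ofReal (D ^ 2) ∧ ‖μ₁ - μ₂‖ ≤ D ∧
      ∃ N₁ N₂ : Matrix (Fin d) (Fin d) ℝ, S₁ - S₂ = CFC.sqrt S₁ * N₁ + N₂ * CFC.sqrt S₂ ∧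
        ‖N₁‖ ≤ (d : ℝ) ^ 2 * D ∧ ‖N₂‖ ≤ (d : ℝ) ^ 2 * D := by
  obtain ⟨hπ₁, hπ₂⟩ := hπ
  have hprob : IsProbabilityMeasure π := by
    have : IsProbabilityMeasure (π.map Prod.fst) := by rw [hπ₁]; infer_instance
    exact Measure.isProbabilityMeasure_of_map Prod.fst
  have hX : MemLp (fun p : E d × E d => p.1) 2 π := by
    have h : MemLp id 2 (π.map Prod.fst) := by rw [hπ₁]; exact IsGaussian.memLp_two_id
    exact (memLp_map_measure_iff h.1 measurable_fst.aemeasurable).1 h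
  have hY : MemLp (fun p : E d × E d => p.2) 2 π := by
    have h : MemLp id 2 (π.map Prod.snd) := by rw [hπ₂]; exact IsGaussian.memLp_two_id
    exact (memLp_map_measure_iff h.1 measurable_snd.aemeasurable).1 h
  have hV := hX.sub hY
  have hXi : ∀ x : E d, MemLp (fun p : E d × E d => inner ℝ x p.1) 2 π := fun x => hX.const_inner x
  have hYi : ∀ x : E d, MemLp (fun p : E d × E d => inner ℝ x p.2) 2 π := fun x => hY.const_inner x
  have hVi : ∀ x : E d, MemLp (fun p : E d × E d => inner ℝ x (p.1 - p.2)) 2 π :=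
    fun x => hV.const_inner x
  have hint : Integrable (fun p : E d × E d => ‖p.1 - p.2‖ ^ 2) π :=
    hV.integrable_norm_pow two_ne_zero
  have hI0 : 0 ≤ ∫ p, ‖p.1 - p.2‖ ^ 2 ∂π := integral_nonneg fun _ => by positivity
  have hD2 : √(∫ p, ‖p.1 - p.2‖ ^ 2 ∂π) ^ 2 = ∫ p, ‖p.1 - p.2‖ ^ 2 ∂π := Real.sq_sqrt hI0
  have hD0 := Real.sqrt_nonneg (∫ p, ‖p.1 - p.2‖ ^ 2 ∂π)
  generalize √(∫ p, ‖p.1 - p.2‖ ^ 2 ∂π) = D at hD2 hD0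
  have covX : ∀ x y : E d, cov[fun p => inner ℝ x p.1, fun p => inner ℝ y p.1; π] =
      inner ℝ x (mulE S₁ y) := by
    intro x y
    have h := covarianceBilin_multivariateGaussian (μ := μ₁) hS₁.posSemidef x y
    rw [covarianceBilin_apply_eq_cov IsGaussian.memLp_two_id, ← hπ₁,
      covariance_map (by fun_prop) (by fun_prop) measurable_fst.aemeasurable] at h
    simpa [EuclideanSpace.inner_eq_star_dotProduct, dotProduct_comm, Function.comp_def] using h
  have covY : ∀ x y : E d, cov[fun p => inner ℝ x p.2, fun p => inner ℝ y p.2; π] =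
      inner ℝ x (mulE S₂ y) := by
    intro x y
    have h := covarianceBilin_multivariateGaussian (μ := μ₂) hS₂.posSemidef x y
    rw [covarianceBilin_apply_eq_cov IsGaussian.memLp_two_id, ← hπ₂,
      covariance_map (by fun_prop) (by fun_prop) measurable_snd.aemeasurable] at h
    simpa [EuclideanSpace.inner_eq_star_dotProduct, dotProduct_comm, Function.comp_def] using h
  let e : Fin d → E d := fun i => EuclideanSpace.single i 1
  have he : ∀ i, ‖e i‖ = 1 := fun i => by simp [e]
  have varV : ∀ j, cov[fun p => inner ℝ (e j) (p.1 - p.2), fun p => inner ℝ (e j) (p.1 - p.2); π]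
      ≤ D ^ 2 := by
    intro j
    rw [covariance_self (hVi _).aemeasurable, hD2]
    refine (variance_le_expectation_sq (hVi _).1).trans ?_
    refine integral_mono_of_nonneg (Filter.Eventually.of_forall fun _ => sq_nonneg _) hint
      (Filter.Eventually.of_forall fun p => ?_)
    have := abs_real_inner_le_norm (e j) (p.1 - p.2)
    rw [he, one_mul] at this
    simpa [sq_abs] using pow_le_pow_left₀ (abs_nonneg _) this 2
  have sqrtY := posDef_sqrt hS₂
  -- The whitened coordinates `⟨S^{-1/2} e i, X⟩` have unit variance, as `covariance_sq_le_variance`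
  -- requires.
  have unit : ∀ {S : Matrix (Fin d) (Fin d) ℝ} (hS : S.PosDef) (i : Fin d),
      inner ℝ (mulE (CFC.sqrt S)⁻¹ (e i)) (mulE S (mulE (CFC.sqrt S)⁻¹ (e i))) = 1 := by
    intro S hS i
    rw [inner_mulE_eq_norm_sqrt hS, mulE_mulE, posDef_mul_inv (posDef_sqrt hS), mulE_one, he]
    norm_num
  refine ⟨D, hD0, ?_, ?_, ?_⟩
  · rw [hD2, ofReal_integral_eq_lintegral_ofReal hint
      (Filter.Eventually.of_forall fun _ => by positivity)]
    refine lintegral_congr fun p => ?_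
    rw [edist_dist, ← ENNReal.ofReal_pow dist_nonneg, dist_eq_norm]
  · have m₁ : ∫ p, p.1 ∂π = μ₁ := by
      have h := integral_id_multivariateGaussian (μ := μ₁) (S := S₁)
      rwa [← hπ₁, integral_map measurable_fst.aemeasurable (by fun_prop)] at h
    have m₂ : ∫ p, p.2 ∂π = μ₂ := by
      have h := integral_id_multivariateGaussian (μ := μ₂) (S := S₂)
      rwa [← hπ₂, integral_map measurable_snd.aemeasurable (by fun_prop)] at h
    have hm : μ₁ - μ₂ = ∫ p, (p.1 - p.2) ∂π := by
      rw [integral_sub (hX.integrable one_le_two) (hY.integrable one_le_two), m₁, m₂]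
    -- Jensen's inequality, in the form of a nonnegative variance of `‖p.1 - p.2‖`.
    refine abs_le_of_sq_le_sq' ?_ hD0 |>.2
    have hN : MemLp (fun p : E d × E d => ‖p.1 - p.2‖) 2 π := hV.norm
    have hv := variance_nonneg (fun p : E d × E d => ‖p.1 - p.2‖) π
    rw [variance_eq_sub hN] at hv
    have h3 : ‖μ₁ - μ₂‖ ≤ ∫ p, ‖p.1 - p.2‖ ∂π := by
      rw [hm]; exact norm_integral_le_integral_norm _
    have h4 : ‖μ₁ - μ₂‖ ^ 2 ≤ (∫ p, ‖p.1 - p.2‖ ∂π) ^ 2 := by gcongr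
    rw [hD2]
    simp only [Pi.pow_apply] at hv
    linarith
  -- With `(X, Y)` distributed as `π`, the witnesses are `N₁ = Cov(S₁^{-1/2} X, X - Y)` and `N₂ =
  -- Cov(X - Y, S₂^{-1/2} Y)`.
  · refine ⟨Matrix.of fun i j => cov[fun p => inner ℝ (mulE (CFC.sqrt S₁)⁻¹ (e i)) p.1,
        fun p => inner ℝ (e j) (p.1 - p.2); π],
      Matrix.of fun i j => cov[fun p => inner ℝ (e i) (p.1 - p.2),
        fun p => inner ℝ (mulE (CFC.sqrt S₂)⁻¹ (e j)) p.2; π], ?_, ?_, ?_⟩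
    · have hS : ∀ (S : Matrix (Fin d) (Fin d) ℝ) i j, inner ℝ (e i) (mulE S (e j)) = S i j := by
        intro S i j
        simp [e, EuclideanSpace.inner_single_left]
      have expand : ∀ {S : Matrix (Fin d) (Fin d) ℝ} (hS : S.PosDef) (i : Fin d) (z : E d),
          inner ℝ (e i) z = ∑ k, (CFC.sqrt S) i k * inner ℝ (mulE (CFC.sqrt S)⁻¹ (e k)) z := by
        intro S hS i z
        have hs := posDef_sqrt hS
        simp_rw [← inner_mulE_symm hs.inv.isHermitian]
        have h1 : inner ℝ (e i) (mulE (CFC.sqrt S) (mulE (CFC.sqrt S)⁻¹ z)) = inner ℝ (e i) z := by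
          rw [mulE_mulE, posDef_mul_inv hs, mulE_one]
        rw [← h1]
        simp [e, EuclideanSpace.inner_single_left, Matrix.mulVec, dotProduct]
      ext i j
      rw [Matrix.sub_apply, Matrix.add_apply, Matrix.mul_apply, Matrix.mul_apply, ← hS S₁ i j,
        ← hS S₂ i j, ← covX, ← covY]
      have t1 : ∑ k, (CFC.sqrt S₁) i k * cov[fun p => inner ℝ (mulE (CFC.sqrt S₁)⁻¹ (e k)) p.1,
          fun p => inner ℝ (e j) (p.1 - p.2); π] =
          cov[fun p => inner ℝ (e i) p.1, fun p => inner ℝ (e j) (p.1 - p.2); π] := by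
        simp_rw [expand hS₁ i]
        rw [covariance_fun_sum_left (fun k => (hXi _).const_mul _) (hVi _)]
        simp_rw [covariance_const_mul_left]
      have t2 : ∑ k, cov[fun p => inner ℝ (e i) (p.1 - p.2),
          fun p => inner ℝ (mulE (CFC.sqrt S₂)⁻¹ (e k)) p.2; π] * (CFC.sqrt S₂) k j =
          cov[fun p => inner ℝ (e i) (p.1 - p.2), fun p => inner ℝ (e j) p.2; π] := by
        simp_rw [expand hS₂ j]
        rw [covariance_fun_sum_right (fun k => (hYi _).const_mul _) (hVi _)]
        simp_rw [covariance_const_mul_right]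
        refine Finset.sum_congr rfl fun k _ => ?_
        have : (CFC.sqrt S₂) k j = (CFC.sqrt S₂) j k := by
          simpa using sqrtY.isHermitian.apply j k
        rw [this, mul_comm]
      simp only [Matrix.of_apply]
      rw [t1, t2]
      -- It remains that `Cov(X, X) - Cov(Y, Y) = Cov(X, X - Y) + Cov(X - Y, Y)`: the mixed terms
      -- cancel.
      simp_rw [inner_sub_right]
      rw [covariance_fun_sub_right (hXi _) (hXi _) (hYi _),
        covariance_fun_sub_left (hXi _) (hYi _) (hYi _)]
      ring
    · refine norm_le_of_abs_apply_le fun i j => ?_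
      refine abs_le_of_sq_le_sq ?_ hD0
      exact (covariance_sq_le_variance (hXi _) (hVi _) ((covX _ _).trans (unit hS₁ i))).trans
        (varV j)
    · refine norm_le_of_abs_apply_le fun i j => ?_
      refine abs_le_of_sq_le_sq ?_ hD0
      rw [Matrix.of_apply, covariance_comm]
      exact (covariance_sq_le_variance (hYi _) (hVi _) ((covY _ _).trans (unit hS₂ j))).trans
        (varV i)

/-! ### Gradients and the divergence for Gaussian densities -/

lemma wnorm_sq {A : Matrix (Fin n) (Fin n) ℝ} (hA : A.PosDef) (x : E n) :
    wnorm A x ^ 2 = inner ℝ x (mulE A⁻¹ x) := by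
  rw [wnorm, ← inv_sqrt_mul_inv_sqrt hA, ← mulE_mulE,
    inner_mulE_symm (posDef_sqrt hA).inv.isHermitian, real_inner_self_eq_norm_sq]

namespace InverseProblem

variable (P : InverseProblem d k)

lemma posDef_B : P.B.PosDef := by
  refine (P.posDef_Γ₀.inv.add_posSemidef ?_).inv
  simpa using P.posDef_Γ.inv.posSemidef.conjTranspose_mul_mul_same P.G

lemma inv_B : P.B⁻¹ = P.Γ₀⁻¹ + P.Gᵀ * P.Γ⁻¹ * P.G := by
  have h : (P.Γ₀⁻¹ + P.Gᵀ * P.Γ⁻¹ * P.G).PosDef := by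
    refine P.posDef_Γ₀.inv.add_posSemidef ?_
    simpa using P.posDef_Γ.inv.posSemidef.conjTranspose_mul_mul_same P.G
  exact Matrix.nonsing_inv_nonsing_inv _ ((Matrix.isUnit_iff_isUnit_det _).1 h.isUnit)

/-- Completion of the square, using `B⁻¹ u₀ = Gᵀ Γ⁻¹ y`. -/
lemma PhiR_eq (u : E d) :
    P.PhiR u = (1 / 2) * inner ℝ (u - P.u₀) (mulE P.B⁻¹ (u - P.u₀)) +
      ((1 / 2) * inner ℝ P.y (mulE P.Γ⁻¹ P.y) - (1 / 2) * inner ℝ P.u₀ (mulE P.B⁻¹ P.u₀)) := by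
  have hB := P.posDef_B
  have hu₀ : mulE P.B⁻¹ P.u₀ = mulE P.Gᵀ (mulE P.Γ⁻¹ P.y) := by
    rw [u₀, mulE_mulE, Matrix.mul_assoc, ← Matrix.mul_assoc, posDef_inv_mul hB, Matrix.one_mul,
      ← mulE_mulE]
  have h1 : inner ℝ u (mulE P.B⁻¹ u) = inner ℝ u (mulE P.Γ₀⁻¹ u) +
      inner ℝ (mulE P.G u) (mulE P.Γ⁻¹ (mulE P.G u)) := by
    rw [P.inv_B, add_mulE, inner_add_right, Matrix.mul_assoc, ← mulE_mulE, inner_mulE_right P.Gᵀ,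
      transpose_transpose, ← mulE_mulE]
  have h2 : inner ℝ u (mulE P.B⁻¹ P.u₀) = inner ℝ (mulE P.G u) (mulE P.Γ⁻¹ P.y) := by
    rw [hu₀, inner_mulE_right, transpose_transpose]
  have h3 : inner ℝ P.u₀ (mulE P.B⁻¹ u) = inner ℝ u (mulE P.B⁻¹ P.u₀) := by
    rw [inner_mulE_symm hB.inv.isHermitian, real_inner_comm]
  have h4 : inner ℝ P.y (mulE P.Γ⁻¹ (mulE P.G u)) = inner ℝ (mulE P.G u) (mulE P.Γ⁻¹ P.y) := by
    rw [inner_mulE_symm P.posDef_Γ.inv.isHermitian, real_inner_comm]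
  rw [PhiR, wnorm_sq P.posDef_Γ, wnorm_sq P.posDef_Γ₀]
  simp only [mulE_sub, inner_sub_left, inner_sub_right]
  rw [h1, h3, h2, h4]
  ring

end InverseProblem

lemma hasFDerivAt_mulE_sub (A : Matrix (Fin d) (Fin d) ℝ) (w u : E d) :
    HasFDerivAt (fun v => mulE A (v - w)) (toEuclideanCLM (n := Fin d) (𝕜 := ℝ) A) u := by
  have h := (toEuclideanCLM (n := Fin d) (𝕜 := ℝ) A).hasFDerivAt.comp u
    ((hasFDerivAt_id u).sub_const w)
  exact h

lemma hasGradientAt_inner_mulE {A : Matrix (Fin d) (Fin d) ℝ} (hA : A.IsHermitian) (w u : E d) :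
    HasGradientAt (fun v => inner ℝ (v - w) (mulE A (v - w))) ((2 : ℝ) • mulE A (u - w)) u := by
  rw [hasGradientAt_iff_hasFDerivAt]
  refine (((hasFDerivAt_id u).sub_const w).inner ℝ (hasFDerivAt_mulE_sub A w u)).congr_fderiv ?_
  ext x
  simp only [ContinuousLinearMap.comp_apply, ContinuousLinearMap.prod_apply,
    ContinuousLinearMap.id_apply, fderivInnerCLM_apply, InnerProductSpace.toDual_apply_apply,
    id]
  rw [← mulE_eq_toEuclideanCLM, inner_mulE_symm hA, inner_smul_left, real_inner_comm x]
  simp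
  ring

lemma InverseProblem.gradient_PhiR (P : InverseProblem d k) (u : E d) :
    gradient P.PhiR u = mulE P.B⁻¹ (u - P.u₀) := by
  have h := ((hasGradientAt_iff_hasFDerivAt.1
    (hasGradientAt_inner_mulE P.posDef_B.inv.isHermitian P.u₀ u)).const_mul (1 / 2)).add_const
    ((1 / 2) * inner ℝ P.y (mulE P.Γ⁻¹ P.y) - (1 / 2) * inner ℝ P.u₀ (mulE P.B⁻¹ P.u₀))
  rw [funext P.PhiR_eq]
  refine HasGradientAt.gradient (hasGradientAt_iff_hasFDerivAt.2 (h.congr_fderiv ?_))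
  rw [map_smul, smul_smul]
  norm_num

lemma hasFDerivAt_gaussianDensity (μ : E d) {S : Matrix (Fin d) (Fin d) ℝ} (hS : S.PosDef)
    (u : E d) : HasFDerivAt (gaussianDensity μ S)
      (-gaussianDensity μ S u • InnerProductSpace.toDual ℝ (E d) (mulE S⁻¹ (u - μ))) u := by
  have h := hasGradientAt_iff_hasFDerivAt.1
    (hasGradientAt_inner_mulE hS.inv.isHermitian μ u)
  have h2 := ((h.const_mul (-(1 / 2))).exp).const_mul
    (((2 * Real.pi) ^ ((d : ℝ) / 2) * √S.det)⁻¹)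
  refine h2.congr_fderiv ?_
  rw [map_smul, smul_smul, smul_smul, smul_smul]
  congr 1
  rw [gaussianDensity]
  ring

lemma gradient_gaussianDensity (μ : E d) {S : Matrix (Fin d) (Fin d) ℝ} (hS : S.PosDef)
    (u : E d) : gradient (gaussianDensity μ S) u =
      -gaussianDensity μ S u • mulE S⁻¹ (u - μ) := by
  refine HasGradientAt.gradient (hasGradientAt_iff_hasFDerivAt.2 ?_)
  simpa using hasFDerivAt_gaussianDensity μ hS u

lemma divergence_gaussianDensity (P : InverseProblem d k) (σ : ℝ) (μ : E d)
    {S : Matrix (Fin d) (Fin d) ℝ} (hS : S.PosDef) (u : E d) :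
    divergence (fun v => mulE S (gaussianDensity μ S v • gradient P.PhiR v +
      σ • gradient (gaussianDensity μ S) v)) u =
    gaussianDensity μ S u * ((S * P.B⁻¹ - σ • (1 : Matrix (Fin d) (Fin d) ℝ)).trace -
      inner ℝ (u - μ) (mulE P.B⁻¹ (u - P.u₀)) + σ * inner ℝ (u - μ) (mulE S⁻¹ (u - μ))) := by
  -- Since `S S⁻¹ = 1`, the flux is the density times an affine field. The divergence of that field
  -- gives the trace, and the gradient of the density gives the quadratic terms.
  have e1 : (fun v => mulE S (gaussianDensity μ S v • gradient P.PhiR v +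
      σ • gradient (gaussianDensity μ S) v)) = fun v => gaussianDensity μ S v •
        (mulE (S * P.B⁻¹) (v - P.u₀) - mulE (σ • (1 : Matrix (Fin d) (Fin d) ℝ)) (v - μ)) := by
    funext v
    rw [P.gradient_PhiR, gradient_gaussianDensity μ hS, mulE_add, mulE_smul, mulE_smul, mulE_smul,
      mulE_mulE, mulE_mulE, posDef_mul_inv hS, smul_mulE, mulE_one]
    module
  rw [e1]
  have h2 : ∀ i : Fin d, fderiv ℝ (fun v => (gaussianDensity μ S v •
      (mulE (S * P.B⁻¹) (v - P.u₀) - mulE (σ • (1 : Matrix (Fin d) (Fin d) ℝ)) (v - μ))) i) u (EuclideanSpace.single i 1) =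
      gaussianDensity μ S u * ((S * P.B⁻¹ - σ • (1 : Matrix (Fin d) (Fin d) ℝ)) i i - (mulE S⁻¹ (u - μ)) i *
        (mulE (S * P.B⁻¹) (u - P.u₀) - mulE (σ • (1 : Matrix (Fin d) (Fin d) ℝ)) (u - μ)) i) := by
    intro i
    have hw := (EuclideanSpace.proj i : E d →L[ℝ] ℝ).hasFDerivAt.comp u
      ((hasFDerivAt_mulE_sub (S * P.B⁻¹) P.u₀ u).sub (hasFDerivAt_mulE_sub (σ • (1 : Matrix (Fin d) (Fin d) ℝ)) μ u))
    have h := (hasFDerivAt_gaussianDensity μ hS u).mul hw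
    have h' : HasFDerivAt (fun v => (gaussianDensity μ S v •
      (mulE (S * P.B⁻¹) (v - P.u₀) - mulE (σ • (1 : Matrix (Fin d) (Fin d) ℝ)) (v - μ))) i) _ u := h
    rw [h'.fderiv, ← map_sub]
    have e3 : (toEuclideanCLM (n := Fin d) (𝕜 := ℝ) (S * P.B⁻¹ - σ • (1 : Matrix (Fin d) (Fin d) ℝ))
        (EuclideanSpace.single i 1)) i = (S * P.B⁻¹ - σ • (1 : Matrix (Fin d) (Fin d) ℝ)) i i := by
      rw [← mulE_eq_toEuclideanCLM]
      simp [mulE]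
    change gaussianDensity μ S u * (toEuclideanCLM (n := Fin d) (𝕜 := ℝ)
        (S * P.B⁻¹ - σ • (1 : Matrix (Fin d) (Fin d) ℝ)) (EuclideanSpace.single i 1)) i +
      (mulE (S * P.B⁻¹) (u - P.u₀) - mulE (σ • (1 : Matrix (Fin d) (Fin d) ℝ)) (u - μ)) i *
        (-gaussianDensity μ S u * inner ℝ (mulE S⁻¹ (u - μ)) (EuclideanSpace.single i 1)) = _
    rw [e3, EuclideanSpace.inner_single_right]
    simp only [conj_trivial, one_mul]
    ring
  rw [divergence, Finset.sum_congr rfl fun i _ => h2 i, ← Finset.mul_sum, Finset.sum_sub_distrib]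
  congr 1
  have e4 : ∀ x y : E d, ∑ i, x i * y i = inner ℝ x y := by
    intro x y
    simp [PiLp.inner_apply, mul_comm]
  rw [e4, inner_sub_right, ← inner_mulE_symm hS.inv.isHermitian,
    ← inner_mulE_symm hS.inv.isHermitian, mulE_mulE, ← mul_assoc, posDef_inv_mul hS, one_mul,
    smul_mulE, mulE_one, mulE_smul, inner_smul_right]
  simp [Matrix.trace]
  ring

/-! ### Evolution of the parameters of a Gaussian solution -/

section Evolution

variable {P : InverseProblem d k} {σ : ℝ} {f : ℝ → E d → ℝ} {μ : ℝ → E d}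
  {S : ℝ → Matrix (Fin d) (Fin d) ℝ}

lemma IsSolution.hasDerivAt_log (hf : IsSolution P σ f) (hS : ∀ t, 0 ≤ t → (S t).PosDef)
    (hfS : ∀ t, 0 ≤ t → f t = gaussianDensity (μ t) (S t)) {t : ℝ} (ht : 0 < t) (u : E d) :
    HasDerivAt (fun s => Real.log (f s u)) ((S t * P.B⁻¹ - σ • (1 : Matrix (Fin d) (Fin d) ℝ)).trace -
      inner ℝ (u - μ t) (mulE P.B⁻¹ (u - P.u₀)) +
      σ * inner ℝ (u - μ t) (mulE (S t)⁻¹ (u - μ t))) t := by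
  have h := hf.equation t ht u
  have hpos := gaussianDensity_pos (μ t) (hS t ht.le) u
  have hft := hfS t ht.le
  rw [hft, cov_gaussianDensity _ (hS t ht.le), divergence_gaussianDensity P σ _ (hS t ht.le)] at h
  have h2 := h.log (by rw [hft]; exact hpos.ne')
  rwa [hft, mul_div_cancel_left₀ _ hpos.ne'] at h2

lemma IsSolution.continuousOn_log (hf : IsSolution P σ f) (hS : ∀ t, 0 ≤ t → (S t).PosDef)
    (hfS : ∀ t, 0 ≤ t → f t = gaussianDensity (μ t) (S t)) (u : E d) :
    ContinuousOn (fun s => Real.log (f s u)) (Set.Ici 0) := by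
  refine (hf.continuousOn u).log fun t ht => ?_
  rw [hfS t ht]
  exact (gaussianDensity_pos _ (hS t ht) u).ne'

lemma log_gaussianDensity (m : E d) {T : Matrix (Fin d) (Fin d) ℝ} (hT : T.PosDef) (u : E d) :
    Real.log (gaussianDensity m T u) = Real.log (((2 * Real.pi) ^ ((d : ℝ) / 2) * √T.det)⁻¹) -
      (1 / 2) * inner ℝ (u - m) (mulE T⁻¹ (u - m)) := by
  have := hT.det_pos
  rw [gaussianDensity, Real.log_mul (by positivity) (Real.exp_pos _).ne', Real.log_exp]
  ring

lemma inner_mulE_add_sub {A : Matrix (Fin d) (Fin d) ℝ} (hA : A.IsHermitian) (w h m : E d) :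
    inner ℝ (w + h - m) (mulE A (w + h - m)) = inner ℝ (m - w) (mulE A (m - w)) -
      2 * inner ℝ h (mulE A (m - w)) + inner ℝ h (mulE A h) := by
  have e : w + h - m = h - (m - w) := by abel
  rw [e]
  generalize m - w = z
  have : inner ℝ z (mulE A h) = inner ℝ h (mulE A z) := by
    rw [inner_mulE_symm hA, real_inner_comm]
  simp only [mulE_sub, inner_sub_left, inner_sub_right, this]
  ring

lemma eventually_nonneg {t : ℝ} (ht : 0 < t) : ∀ᶠ s in nhds t, 0 ≤ s :=
  (eventually_gt_nhds ht).mono fun _ h => h.le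

/-- A symmetric second difference of `log f` cancels the normalization and the mean. Since `μ` and
`S` carry no assumed regularity in time, this and `linForm_eq_log` are how continuity and
differentiability reach them from the pointwise values of `f`. The spelling `w + 0` lets
`inner_mulE_add_sub` rewrite all three terms. -/
lemma quadForm_eq_log (hS : ∀ t, 0 ≤ t → (S t).PosDef)
    (hfS : ∀ t, 0 ≤ t → f t = gaussianDensity (μ t) (S t)) (w h : E d) {t : ℝ} (ht : 0 ≤ t) :
    inner ℝ h (mulE (S t)⁻¹ h) = 2 * Real.log (f t (w + 0)) - Real.log (f t (w + h)) -
      Real.log (f t (w + -h)) := by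
  have hH := (hS t ht).inv.isHermitian
  simp only [hfS t ht, log_gaussianDensity _ (hS t ht), inner_mulE_add_sub hH]
  simp only [mulE_neg, inner_neg_left, inner_neg_right, mulE_zero, inner_zero_left]
  ring

/-- The odd difference of `log f` cancels the normalization and the even part. -/
lemma linForm_eq_log (hS : ∀ t, 0 ≤ t → (S t).PosDef)
    (hfS : ∀ t, 0 ≤ t → f t = gaussianDensity (μ t) (S t)) (w h : E d) {t : ℝ} (ht : 0 ≤ t) :
    inner ℝ h (mulE (S t)⁻¹ (μ t - w)) = (Real.log (f t (w + h)) -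
      Real.log (f t (w + -h))) / 2 := by
  have hH := (hS t ht).inv.isHermitian
  simp only [hfS t ht, log_gaussianDensity _ (hS t ht), inner_mulE_add_sub hH]
  simp only [mulE_neg, inner_neg_left, inner_neg_right]
  ring

lemma IsSolution.continuousOn_quadForm (hf : IsSolution P σ f) (hS : ∀ t, 0 ≤ t → (S t).PosDef)
    (hfS : ∀ t, 0 ≤ t → f t = gaussianDensity (μ t) (S t)) (h : E d) :
    ContinuousOn (fun t => inner ℝ h (mulE (S t)⁻¹ h)) (Set.Ici 0) := by
  have hl := fun u => hf.continuousOn_log hS hfS u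
  exact ((((hl (0 + 0)).const_mul 2).sub (hl (0 + h))).sub (hl (0 + -h))).congr
    fun t ht => quadForm_eq_log hS hfS 0 h ht

lemma IsSolution.continuousOn_linForm (hf : IsSolution P σ f) (hS : ∀ t, 0 ≤ t → (S t).PosDef)
    (hfS : ∀ t, 0 ≤ t → f t = gaussianDensity (μ t) (S t)) (h : E d) :
    ContinuousOn (fun t => inner ℝ h (mulE (S t)⁻¹ (μ t - P.u₀))) (Set.Ici 0) := by
  have hl := fun u => hf.continuousOn_log hS hfS u
  exact (((hl (P.u₀ + h)).sub (hl (P.u₀ + -h))).div_const 2).congr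
    fun t ht => linForm_eq_log hS hfS P.u₀ h ht

lemma IsSolution.hasDerivAt_quadForm (hf : IsSolution P σ f) (hS : ∀ t, 0 ≤ t → (S t).PosDef)
    (hfS : ∀ t, 0 ≤ t → f t = gaussianDensity (μ t) (S t)) (h : E d) {t : ℝ} (ht : 0 < t) :
    HasDerivAt (fun t => inner ℝ h (mulE (S t)⁻¹ h))
      (2 * inner ℝ h (mulE P.B⁻¹ h) - 2 * σ * inner ℝ h (mulE (S t)⁻¹ h)) t := by
  have hl := fun u => hf.hasDerivAt_log hS hfS ht u
  have hd := (((hl (P.u₀ + 0)).const_mul 2).sub (hl (P.u₀ + h))).sub (hl (P.u₀ + -h))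
  refine (hd.congr_of_eventuallyEq ((eventually_nonneg ht).mono fun s hs =>
    quadForm_eq_log hS hfS P.u₀ h hs)).congr_deriv ?_
  simp only [inner_mulE_add_sub (hS t ht.le).inv.isHermitian]
  simp only [add_sub_cancel_left, mulE_neg, inner_neg_left, inner_neg_right, mulE_zero,
    inner_zero_left, inner_zero_right]
  simp only [add_sub_right_comm, inner_add_left, inner_neg_left]
  ring

lemma IsSolution.hasDerivAt_linForm (hf : IsSolution P σ f) (hS : ∀ t, 0 ≤ t → (S t).PosDef)
    (hfS : ∀ t, 0 ≤ t → f t = gaussianDensity (μ t) (S t)) (h : E d) {t : ℝ} (ht : 0 < t) :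
    HasDerivAt (fun t => inner ℝ h (mulE (S t)⁻¹ (μ t - P.u₀)))
      (inner ℝ h (mulE P.B⁻¹ (μ t - P.u₀)) -
        2 * σ * inner ℝ h (mulE (S t)⁻¹ (μ t - P.u₀))) t := by
  have hl := fun u => hf.hasDerivAt_log hS hfS ht u
  have hd := ((hl (P.u₀ + h)).sub (hl (P.u₀ + -h))).div_const 2
  refine (hd.congr_of_eventuallyEq ((eventually_nonneg ht).mono fun s hs =>
    linForm_eq_log hS hfS P.u₀ h hs)).congr_deriv ?_
  simp only [inner_mulE_add_sub (hS t ht.le).inv.isHermitian]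
  simp only [add_sub_cancel_left, mulE_neg, inner_neg_left, inner_neg_right]
  have e : inner ℝ h (mulE P.B⁻¹ (μ t - P.u₀)) = - inner ℝ (P.u₀ - μ t) (mulE P.B⁻¹ h) := by
    rw [inner_mulE_symm P.posDef_B.inv.isHermitian, ← neg_sub, inner_neg_right, real_inner_comm]
  rw [e]
  simp only [add_sub_right_comm, inner_add_left, inner_neg_left]
  ring

end Evolution

/-! ### The explicit form of the parameters -/

/-- The time change `γ` with `γ(0) = 0` and `γ'(t) = 2 e^{2σt}`. -/
def timeChange (σ t : ℝ) : ℝ :=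
  if σ = 0 then 2 * t else (Real.exp (2 * σ * t) - 1) / σ

lemma timeChange_zero (σ : ℝ) : timeChange σ 0 = 0 := by
  simp [timeChange]

lemma hasDerivAt_exp_two_mul (σ t : ℝ) :
    HasDerivAt (fun t => Real.exp (2 * σ * t)) (2 * σ * Real.exp (2 * σ * t)) t := by
  refine (((hasDerivAt_id t).const_mul (2 * σ)).exp).congr_deriv ?_
  simp
  ring

lemma hasDerivAt_timeChange (σ t : ℝ) :
    HasDerivAt (timeChange σ) (2 * Real.exp (2 * σ * t)) t := by
  by_cases hσ : σ = 0
  · have e : timeChange σ = fun t => 2 * t := by funext; simp [timeChange, hσ]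
    rw [e]
    refine ((hasDerivAt_id t).const_mul 2).congr_deriv ?_
    simp [hσ]
  · have e : timeChange σ = fun t => (Real.exp (2 * σ * t) - 1) / σ := by
      funext; simp [timeChange, hσ]
    rw [e]
    refine (((hasDerivAt_exp_two_mul σ t).sub_const 1).div_const σ).congr_deriv ?_
    field_simp

lemma continuous_timeChange (σ : ℝ) : Continuous (timeChange σ) :=
  continuous_iff_continuousAt.2 fun t => (hasDerivAt_timeChange σ t).continuousAt

lemma timeChange_nonneg {σ t : ℝ} (hσ : 0 ≤ σ) (ht : 0 ≤ t) : 0 ≤ timeChange σ t := by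
  unfold timeChange
  split_ifs with h
  · positivity
  · have : 1 ≤ Real.exp (2 * σ * t) := Real.one_le_exp (by positivity)
    exact div_nonneg (by linarith) hσ

lemma alpha_eq (σ t : ℝ) :
    alpha σ t = Real.exp (-σ * t) ^ 2 * (1 + timeChange σ t) := by
  have h1 : Real.exp (-σ * t) ^ 2 = Real.exp (-2 * σ * t) := by
    rw [← Real.exp_nat_mul]; congr 1; push_cast; ring
  rw [h1]
  unfold alpha timeChange
  split_ifs with h
  · simp [h]; ring
  · have h2 : Real.exp (-2 * σ * t) * Real.exp (2 * σ * t) = 1 := by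
      rw [← Real.exp_add]; ring_nf; simp
    generalize Real.exp (-2 * σ * t) = x at *
    generalize Real.exp (2 * σ * t) = y at *
    field_simp
    linear_combination -h2

lemma eq_apply_zero_of_hasDerivAt_zero {F : ℝ → ℝ} (hc : ContinuousOn F (Set.Ici 0))
    (hd : ∀ t, 0 < t → HasDerivAt F 0 t) {t : ℝ} (ht : 0 ≤ t) : F t = F 0 := by
  rcases ht.eq_or_lt with rfl | ht
  · rfl
  obtain ⟨c, _, hc'⟩ := exists_hasDerivAt_eq_slope F (fun _ => 0) ht
    (hc.mono Set.Icc_subset_Ici_self) fun x hx => hd x hx.1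
  rw [eq_comm, div_eq_zero_iff] at hc'
  rcases hc' with h | h <;> linarith

/-- The derivative of `timeChange σ` is `2 e^{2σt}`, so the equation reads `(log y)' = (1/2) (log (κ
+ γ))'` where `y ≠ 0`; dividing by the square root covers zeros as well. -/
lemma mul_sqrt_eq_of_hasDerivAt {σ κ : ℝ} (hσ : 0 ≤ σ) (hκ : 0 < κ) {y : ℝ → ℝ}
    (hc : ContinuousOn y (Set.Ici 0))
    (hd : ∀ t, 0 < t → HasDerivAt y (Real.exp (2 * σ * t) * (y t / (κ + timeChange σ t))) t)
    {t : ℝ} (ht : 0 ≤ t) : y t / √(κ + timeChange σ t) = y 0 / √κ := by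
  have hpos : ∀ t, 0 ≤ t → 0 < κ + timeChange σ t := fun t ht => by
    have := timeChange_nonneg hσ ht
    positivity
  have h := eq_apply_zero_of_hasDerivAt_zero (F := fun t => y t / √(κ + timeChange σ t)) ?_ ?_ ht
  · simpa [timeChange_zero] using h
  · refine hc.div ?_ fun t ht => (Real.sqrt_pos.2 (hpos t ht)).ne'
    exact ((continuous_timeChange σ).const_add κ).sqrt.continuousOn
  · intro t ht
    have hp := hpos t ht.le
    have hs := Real.sqrt_pos.2 hp
    have h2 := ((hasDerivAt_timeChange σ t).const_add κ).sqrt hp.ne'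
    refine ((hd t ht).div h2 hs.ne').congr_deriv ?_
    rw [div_eq_zero_iff]
    left
    nth_rewrite 1 [← Real.sq_sqrt hp.le]
    field_simp
    ring

/-- The vector `√A v - l v` is sent by `√A` to `-l` times itself, which positivity of `√A` allows
only for zero. -/
lemma mulE_sqrt_of_mulE_eq {A : Matrix (Fin d) (Fin d) ℝ} (hA : A.PosDef) {l : ℝ} (hl : 0 < l)
    {v : E d} (hv : mulE A v = l ^ 2 • v) : mulE (CFC.sqrt A) v = l • v := by
  have h1 : mulE (CFC.sqrt A) (mulE (CFC.sqrt A) v - l • v) =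
      -(l • (mulE (CFC.sqrt A) v - l • v)) := by
    rw [mulE_sub, mulE_mulE, sqrt_mul_sqrt hA, hv, mulE_smul, smul_sub, smul_smul]
    ring_nf
    module
  have h2 := inner_mulE_nonneg (posDef_sqrt hA) (mulE (CFC.sqrt A) v - l • v)
  rw [h1, inner_neg_right, inner_smul_right, real_inner_self_eq_norm_sq] at h2
  have h3 : ‖mulE (CFC.sqrt A) v - l • v‖ ^ 2 = 0 := by
    have := sq_nonneg ‖mulE (CFC.sqrt A) v - l • v‖
    nlinarith
  rw [← sub_eq_zero]
  simpa using h3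

lemma exists_eigenbasis {A : Matrix (Fin d) (Fin d) ℝ} (hA : A.PosDef) :
    ∃ (v : Fin d → E d) (ν : Fin d → ℝ), (∀ i, 0 < ν i) ∧ (∀ i, mulE A (v i) = ν i • v i) ∧
      ∀ x y : E d, (∀ i, inner ℝ (v i) x = inner ℝ (v i) y) → x = y := by
  refine ⟨hA.isHermitian.eigenvectorBasis, hA.isHermitian.eigenvalues, hA.eigenvalues_pos,
    fun i => ?_, fun x y h => ?_⟩
  · have h := hA.isHermitian.mulVec_eigenvectorBasis i
    exact congrArg (WithLp.toLp 2) h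
  · refine hA.isHermitian.eigenvectorBasis.repr.injective ?_
    ext i
    simpa only [OrthonormalBasis.repr_apply_apply] using h i

lemma posDef_conj_inv_sqrt {B S : Matrix (Fin d) (Fin d) ℝ} (hB : B.PosDef) (hS : S.PosDef) :
    ((CFC.sqrt B)⁻¹ * S * (CFC.sqrt B)⁻¹).PosDef := by
  have hc := (posDef_sqrt hB).inv
  have h := (Matrix.IsUnit.posDef_star_left_conjugate_iff hc.isUnit (x := S)).2 hS
  rwa [star_eq_conjTranspose, hc.isHermitian.eq] at h

lemma posDef_one_add_smul {N : Matrix (Fin d) (Fin d) ℝ} (hN : N.PosDef) {r : ℝ} (hr : 0 ≤ r) :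
    (1 + r • N).PosDef :=
  PosDef.one.add_posSemidef (hN.posSemidef.smul hr)

section Evolution

variable {P : InverseProblem d k} {σ : ℝ} {f : ℝ → E d → ℝ} {μ : ℝ → E d}
  {S : ℝ → Matrix (Fin d) (Fin d) ℝ}

lemma IsSolution.inv_cov_eq (hf : IsSolution P σ f) (hS : ∀ t, 0 ≤ t → (S t).PosDef)
    (hfS : ∀ t, 0 ≤ t → f t = gaussianDensity (μ t) (S t)) {t : ℝ} (ht : 0 ≤ t) :
    (S t)⁻¹ = Real.exp (-σ * t) ^ 2 • ((S 0)⁻¹ + timeChange σ t • P.B⁻¹) := by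
  refine isHermitian_ext (hS t ht).inv.isHermitian ?_ fun h => ?_
  · have h1 := (hS 0 le_rfl).inv.isHermitian
    have h2 := P.posDef_B.inv.isHermitian
    unfold Matrix.IsHermitian at *
    simp only [conjTranspose_smul, conjTranspose_add, h1, h2, star_trivial]
  -- The equation for `S⁻¹` integrates with the factor `e^{2σt}`.
  have key := eq_apply_zero_of_hasDerivAt_zero (F := fun t => Real.exp (2 * σ * t) *
    inner ℝ h (mulE (S t)⁻¹ h) - timeChange σ t * inner ℝ h (mulE P.B⁻¹ h)) ?_ ?_ ht
  · simp only [timeChange_zero, mul_zero, Real.exp_zero, one_mul, zero_mul, sub_zero] at key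
    have h1 : Real.exp (-σ * t) ^ 2 * Real.exp (2 * σ * t) = 1 := by
      rw [← Real.exp_nat_mul, ← Real.exp_add]; push_cast; ring_nf; simp
    rw [smul_mulE, add_mulE, smul_mulE, inner_smul_right, inner_add_right, inner_smul_right, ← key,
      sub_add_cancel, ← mul_assoc, h1, one_mul]
  · have h1 : Continuous fun t => Real.exp (2 * σ * t) := by fun_prop
    exact (h1.continuousOn.mul (hf.continuousOn_quadForm hS hfS h)).sub
      ((continuous_timeChange σ).mul continuous_const).continuousOn
  · intro t ht
    refine (((hasDerivAt_exp_two_mul σ t).mul (hf.hasDerivAt_quadForm hS hfS h ht)).sub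
      ((hasDerivAt_timeChange σ t).mul_const _)).congr_deriv ?_
    ring

/-- For an eigenvector `v i` of `N` with eigenvalue `ν i`, the vector `w = √B (v i)` makes `S₀⁻¹ w`
and `B⁻¹ w` parallel. So `(S t)⁻¹ w` stays parallel to them, and pairing the equation for `S⁻¹ (μ -
u₀)` with `w` closes into the scalar equation of `mul_sqrt_eq_of_hasDerivAt` with `κ = (ν i)⁻¹`. -/
lemma IsSolution.mean_eq (hf : IsSolution P σ f) (hσ : 0 ≤ σ) (hS : ∀ t, 0 ≤ t → (S t).PosDef)
    (hfS : ∀ t, 0 ≤ t → f t = gaussianDensity (μ t) (S t)) {t : ℝ} (ht : 0 ≤ t) :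
    mulE (CFC.sqrt (1 + timeChange σ t • ((CFC.sqrt P.B)⁻¹ * S 0 * (CFC.sqrt P.B)⁻¹)))
      (mulE (CFC.sqrt P.B)⁻¹ (μ t - P.u₀)) = mulE (CFC.sqrt P.B)⁻¹ (μ 0 - P.u₀) := by
  have hN := posDef_conj_inv_sqrt P.posDef_B (hS 0 le_rfl)
  have hc := posDef_sqrt P.posDef_B
  set c := CFC.sqrt P.B
  set N := c⁻¹ * S 0 * c⁻¹ with hNdef
  obtain ⟨v, ν, hν, hv, hext⟩ := exists_eigenbasis hN
  refine hext _ _ fun i => ?_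
  have hνi := hν i
  have hγ := timeChange_nonneg hσ ht
  have hl : 0 < 1 + timeChange σ t * ν i := by positivity
  have hR : mulE (CFC.sqrt (1 + timeChange σ t • N)) (v i) = √(1 + timeChange σ t * ν i) • v i := by
    refine mulE_sqrt_of_mulE_eq (posDef_one_add_smul hN hγ) (Real.sqrt_pos.2 hl) ?_
    rw [Real.sq_sqrt hl.le, add_mulE, mulE_one, smul_mulE, hv]
    module
  rw [inner_mulE_symm (posDef_sqrt (posDef_one_add_smul hN hγ)).isHermitian, hR,
    inner_smul_left, conj_trivial]
  set w := mulE c (v i) with hw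
  have hHw : mulE P.B⁻¹ w = mulE c⁻¹ (v i) := by
    rw [hw, ← inv_sqrt_mul_inv_sqrt P.posDef_B, mulE_mulE, mul_assoc, posDef_inv_mul hc, mul_one]
  have hXw : mulE (S 0)⁻¹ w = (ν i)⁻¹ • mulE c⁻¹ (v i) := by
    have h1 : mulE c (mulE N (v i)) = mulE (S 0) (mulE c⁻¹ (v i)) := by
      rw [mulE_mulE, mulE_mulE, hNdef, ← mul_assoc, ← mul_assoc, posDef_mul_inv hc, one_mul]
    rw [hv, mulE_smul, ← hw] at h1
    have h2 : ν i • mulE (S 0)⁻¹ w = mulE c⁻¹ (v i) := by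
      rw [← mulE_smul, h1, mulE_mulE, posDef_inv_mul (hS 0 le_rfl), mulE_one]
    rw [← h2, smul_smul, inv_mul_cancel₀ hνi.ne', one_smul]
  have hexp : ∀ t, Real.exp (2 * σ * t) * Real.exp (-σ * t) ^ 2 = 1 := by
    intro t
    rw [← Real.exp_nat_mul, ← Real.exp_add]; push_cast; ring_nf; simp
  have hy : ∀ t, 0 ≤ t → Real.exp (2 * σ * t) * inner ℝ w (mulE (S t)⁻¹ (μ t - P.u₀)) =
      ((ν i)⁻¹ + timeChange σ t) * inner ℝ (v i) (mulE c⁻¹ (μ t - P.u₀)) := by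
    intro t ht
    rw [inner_mulE_symm (hS t ht).inv.isHermitian, hf.inv_cov_eq hS hfS ht, smul_mulE, add_mulE,
      smul_mulE, hHw, hXw, ← add_smul, smul_smul, inner_smul_left, conj_trivial, ← mul_assoc,
      ← mul_assoc, hexp, one_mul, inner_mulE_symm hc.inv.isHermitian]
  have key := mul_sqrt_eq_of_hasDerivAt hσ (inv_pos.2 hνi)
    (y := fun t => Real.exp (2 * σ * t) * inner ℝ w (mulE (S t)⁻¹ (μ t - P.u₀))) ?_ ?_ ht
  · simp only [hy t ht, hy 0 le_rfl, timeChange_zero, add_zero] at key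
    have hp : 0 < (ν i)⁻¹ + timeChange σ t := by positivity
    have e1 : ∀ x : ℝ, 0 ≤ x → ∀ p : ℝ, x * p / √x = √x * p := by
      intro x hx p
      rw [mul_div_right_comm, Real.div_sqrt]
    rw [e1 _ hp.le, e1 _ (inv_pos.2 hνi).le] at key
    have e2 : 1 + timeChange σ t * ν i = ν i * ((ν i)⁻¹ + timeChange σ t) := by
      field_simp
    rw [e2, Real.sqrt_mul hνi.le, mul_assoc, key, ← mul_assoc, ← Real.sqrt_mul hνi.le,
      mul_inv_cancel₀ hνi.ne', Real.sqrt_one, one_mul]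
  · have h1 : Continuous fun t => Real.exp (2 * σ * t) := by fun_prop
    exact h1.continuousOn.mul (hf.continuousOn_linForm hS hfS w)
  · intro t ht
    refine ((hasDerivAt_exp_two_mul σ t).mul (hf.hasDerivAt_linForm hS hfS w ht)).congr_deriv ?_
    have hγ := timeChange_nonneg hσ ht.le
    have hp : 0 < (ν i)⁻¹ + timeChange σ t := by positivity
    rw [hy t ht.le, mul_div_cancel_left₀ _ hp.ne', inner_mulE_symm P.posDef_B.inv.isHermitian w,
      hHw, ← inner_mulE_symm hc.inv.isHermitian]
    ring

end Evolution

/-! ### Stability estimates -/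

lemma norm_sq_eq_norm_mul_self {A : Matrix (Fin d) (Fin d) ℝ} (hA : A.IsHermitian) :
    ‖A‖ ^ 2 = ‖A * A‖ := by
  have h := l2_opNorm_conjTranspose_mul_self A
  rw [hA.eq] at h
  rw [h, sq]

lemma norm_sqrt_le {A : Matrix (Fin d) (Fin d) ℝ} (hA : A.PosDef) {M : ℝ} (hM : ‖A‖ ≤ M) :
    ‖CFC.sqrt A‖ ≤ √M := by
  apply Real.le_sqrt_of_sq_le
  rwa [norm_sq_eq_norm_mul_self (posDef_sqrt hA).isHermitian, sqrt_mul_sqrt hA]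

lemma norm_inv_sqrt_le {A : Matrix (Fin d) (Fin d) ℝ} (hA : A.PosDef) {m : ℝ} (hm : ‖A⁻¹‖ ≤ m) :
    ‖(CFC.sqrt A)⁻¹‖ ≤ √m := by
  apply Real.le_sqrt_of_sq_le
  rwa [norm_sq_eq_norm_mul_self (posDef_sqrt hA).inv.isHermitian, inv_sqrt_mul_inv_sqrt hA]

lemma inv_inv_of_posDef {A : Matrix (Fin d) (Fin d) ℝ} (hA : A.PosDef) : A⁻¹⁻¹ = A :=
  Matrix.nonsing_inv_nonsing_inv _ ((Matrix.isUnit_iff_isUnit_det _).1 hA.isUnit)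

section Cov

variable {S B Y : Matrix (Fin d) (Fin d) ℝ} {M ρ g : ℝ}

lemma norm_le_of_inv_eq (hS : S.PosDef) (hB : B.PosDef) (hY : Y.PosDef) (hρ : 0 < ρ) (hg : 0 ≤ g)
    (hM : 0 < M) (hYe : Y⁻¹ = ρ ^ 2 • (S⁻¹ + g • B⁻¹)) (hSM : ‖S‖ ≤ M) (hBM : ‖B‖ ≤ M) :
    ‖Y‖ ≤ M / (ρ ^ 2 * (1 + g)) := by
  have h := norm_inv_le_of_le_inner hY.inv (c := ρ ^ 2 * (1 + g) / M) (by positivity) fun x => ?_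
  · rwa [inv_inv_of_posDef hY, one_div_div] at h
  · have h1 := norm_sq_le_of_norm_inv_le hS.inv (m := M) (by rwa [inv_inv_of_posDef hS]) x
    have h2 := norm_sq_le_of_norm_inv_le hB.inv (m := M) (by rwa [inv_inv_of_posDef hB]) x
    rw [hYe, smul_mulE, add_mulE, smul_mulE, inner_smul_right, inner_add_right, inner_smul_right,
      div_mul_eq_mul_div, div_le_iff₀ hM]
    calc ρ ^ 2 * (1 + g) * ‖x‖ ^ 2 = ρ ^ 2 * (‖x‖ ^ 2 + g * ‖x‖ ^ 2) := by ring
      _ ≤ ρ ^ 2 * (M * inner ℝ x (mulE S⁻¹ x) + g * (M * inner ℝ x (mulE B⁻¹ x))) := by gcongr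
      _ = _ := by ring

/-- Dropping the nonnegative term `g B⁻¹` leaves `ρ² S⁻¹ ≤ Y⁻¹` as quadratic forms. -/
lemma norm_inv_sqrt_mul_sqrt_le (hS : S.PosDef) (hB : B.PosDef) (hY : Y.PosDef) (hρ : 0 < ρ)
    (hg : 0 ≤ g) (hYe : Y⁻¹ = ρ ^ 2 • (S⁻¹ + g • B⁻¹)) :
    ‖(CFC.sqrt S)⁻¹ * CFC.sqrt Y‖ ≤ 1 / ρ := by
  refine norm_le_of_mulE_le (by positivity) fun x => ?_
  have hy := posDef_sqrt hY
  have h1 : ‖mulE ((CFC.sqrt S)⁻¹ * CFC.sqrt Y) x‖ ^ 2 =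
      inner ℝ (mulE (CFC.sqrt Y) x) (mulE S⁻¹ (mulE (CFC.sqrt Y) x)) := by
    rw [← inv_sqrt_mul_inv_sqrt hS, ← mulE_mulE, ← mulE_mulE,
      inner_mulE_symm (posDef_sqrt hS).inv.isHermitian, real_inner_self_eq_norm_sq]
  have h2 : inner ℝ (mulE (CFC.sqrt Y) x) (mulE Y⁻¹ (mulE (CFC.sqrt Y) x)) = ‖x‖ ^ 2 := by
    rw [← inv_sqrt_mul_inv_sqrt hY, ← mulE_mulE, inner_mulE_symm hy.inv.isHermitian, mulE_mulE,
      posDef_inv_mul hy, mulE_one, real_inner_self_eq_norm_sq]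
  have h3 := inner_mulE_nonneg hB.inv (mulE (CFC.sqrt Y) x)
  rw [hYe, smul_mulE, add_mulE, smul_mulE, inner_smul_right, inner_add_right, inner_smul_right,
    ← h1] at h2
  have h4 : (ρ * ‖mulE ((CFC.sqrt S)⁻¹ * CFC.sqrt Y) x‖) ^ 2 ≤ ‖x‖ ^ 2 := by
    rw [← h2, mul_pow]
    gcongr
    exact le_add_of_nonneg_right (by positivity)
  have h5 := (pow_le_pow_iff_left₀ (by positivity) (norm_nonneg _) two_ne_zero).1 h4
  rw [div_mul_eq_mul_div, one_mul, le_div_iff₀ hρ]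
  linarith

lemma norm_sqrt_mul_inv_sqrt_le (hS : S.PosDef) (hB : B.PosDef) (hY : Y.PosDef) (hρ : 0 < ρ)
    (hg : 0 ≤ g) (hYe : Y⁻¹ = ρ ^ 2 • (S⁻¹ + g • B⁻¹)) :
    ‖CFC.sqrt Y * (CFC.sqrt S)⁻¹‖ ≤ 1 / ρ := by
  have h := norm_inv_sqrt_mul_sqrt_le hS hB hY hρ hg hYe
  rw [← l2_opNorm_conjTranspose, conjTranspose_mul, (posDef_sqrt hY).isHermitian.eq,
    (posDef_sqrt hS).inv.isHermitian.eq] at h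
  exact h

end Cov

/-- The difference `Q = √Y₁ - √Y₂` satisfies `√Y₁ Q + Q √Y₂ = Y₁ - Y₂`, and the resolvent identity
expresses the right side through `S₁ - S₂`. The factors `√S₁` and `√S₂` in `hN` absorb half of an
inverse, so only one power of `m` is lost. -/
lemma norm_sqrt_sub_sqrt_le {S₁ S₂ B Y₁ Y₂ N₁ N₂ : Matrix (Fin d) (Fin d) ℝ} {M m ρ g : ℝ}
    (hS₁ : S₁.PosDef) (hS₂ : S₂.PosDef) (hB : B.PosDef) (hY₁ : Y₁.PosDef) (hY₂ : Y₂.PosDef)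
    (hρ : 0 < ρ) (hg : 0 ≤ g) (hM : 0 < M)
    (hYe₁ : Y₁⁻¹ = ρ ^ 2 • (S₁⁻¹ + g • B⁻¹)) (hYe₂ : Y₂⁻¹ = ρ ^ 2 • (S₂⁻¹ + g • B⁻¹))
    (hSM₁ : ‖S₁‖ ≤ M) (hSM₂ : ‖S₂‖ ≤ M) (hBM : ‖B‖ ≤ M) (hm₁ : ‖S₁⁻¹‖ ≤ m) (hm₂ : ‖S₂⁻¹‖ ≤ m)
    (hN : S₁ - S₂ = CFC.sqrt S₁ * N₁ + N₂ * CFC.sqrt S₂) :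
    ‖CFC.sqrt Y₁ - CFC.sqrt Y₂‖ ≤
      (d : ℝ) ^ 2 * (m * M / (ρ * (1 + g)) * (‖N₁‖ + ‖N₂‖)) := by
  have hs₁ := posDef_sqrt hS₁
  have hs₂ := posDef_sqrt hS₂
  set a := CFC.sqrt Y₁ with ha
  set b := CFC.sqrt Y₂ with hb
  set s₁ := CFC.sqrt S₁
  set s₂ := CFC.sqrt S₂
  have haa : a * a = Y₁ := sqrt_mul_sqrt hY₁
  have hbb : b * b = Y₂ := sqrt_mul_sqrt hY₂
  have hm0 : 0 ≤ m := (norm_nonneg _).trans hm₁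
  have e1 : Y₁ - Y₂ = ρ ^ 2 • (Y₁ * S₁⁻¹ * (S₁ - S₂) * S₂⁻¹ * Y₂) := by
    have h1 : Y₁ * (Y₂⁻¹ - Y₁⁻¹) * Y₂ = Y₁ - Y₂ := by
      rw [mul_sub, sub_mul, posDef_mul_inv hY₁, one_mul, mul_assoc, posDef_inv_mul hY₂, mul_one]
    have h2 : S₁⁻¹ * (S₁ - S₂) * S₂⁻¹ = S₂⁻¹ - S₁⁻¹ := by
      rw [mul_sub, sub_mul, posDef_inv_mul hS₁, one_mul, mul_assoc, posDef_mul_inv hS₂, mul_one]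
    have h3 : Y₂⁻¹ - Y₁⁻¹ = ρ ^ 2 • (S₂⁻¹ - S₁⁻¹) := by
      rw [hYe₁, hYe₂]
      module
    rw [← h1, h3, ← h2, mul_smul_comm, smul_mul_assoc]
    simp only [mul_assoc]
  have r1 : S₁⁻¹ * s₁ = s₁⁻¹ := by
    rw [← inv_sqrt_mul_inv_sqrt hS₁, mul_assoc, posDef_inv_mul hs₁, mul_one]
  have r2 : s₂ * S₂⁻¹ = s₂⁻¹ := by
    rw [← inv_sqrt_mul_inv_sqrt hS₂, ← mul_assoc, posDef_mul_inv hs₂, one_mul]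
  -- One factor `a` on the left and one factor `b` on the right are split off, to match
  -- `norm_le_of_sylvester`.
  have key : a * (a - b) + (a - b) * b = a * (ρ ^ 2 • ((a * s₁⁻¹) * N₁ * S₂⁻¹ * Y₂)) +
      (ρ ^ 2 • (Y₁ * S₁⁻¹ * N₂ * (s₂⁻¹ * b))) * b := by
    have h1 : a * (a - b) + (a - b) * b = Y₁ - Y₂ := by
      rw [← haa, ← hbb]; noncomm_ring
    have h2 : Y₁ * S₁⁻¹ * (s₁ * N₁) * S₂⁻¹ * Y₂ = a * ((a * s₁⁻¹) * N₁ * S₂⁻¹ * Y₂) := by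
      rw [← r1, ← haa]; simp only [mul_assoc]
    have h3 : Y₁ * S₁⁻¹ * (N₂ * s₂) * S₂⁻¹ * Y₂ = (Y₁ * S₁⁻¹ * N₂ * (s₂⁻¹ * b)) * b := by
      rw [← r2, ← hbb]; simp only [mul_assoc]
    rw [h1, e1, hN, mul_add, add_mul, add_mul, h2, h3, smul_add, mul_smul_comm, smul_mul_assoc]
  have nY₁ := norm_le_of_inv_eq hS₁ hB hY₁ hρ hg hM hYe₁ hSM₁ hBM
  have nY₂ := norm_le_of_inv_eq hS₂ hB hY₂ hρ hg hM hYe₂ hSM₂ hBM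
  have n1 := norm_sqrt_mul_inv_sqrt_le hS₁ hB hY₁ hρ hg hYe₁
  have n2 := norm_inv_sqrt_mul_sqrt_le hS₂ hB hY₂ hρ hg hYe₂
  refine (norm_le_of_sylvester (posDef_sqrt hY₁) (posDef_sqrt hY₂) key).trans ?_
  have p1 : ‖ρ ^ 2 • ((a * s₁⁻¹) * N₁ * S₂⁻¹ * Y₂)‖ ≤ m * M / (ρ * (1 + g)) * ‖N₁‖ := by
    rw [norm_smul, Real.norm_of_nonneg (by positivity)]
    calc ρ ^ 2 * ‖(a * s₁⁻¹) * N₁ * S₂⁻¹ * Y₂‖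
        ≤ ρ ^ 2 * (‖a * s₁⁻¹‖ * ‖N₁‖ * ‖S₂⁻¹‖ * ‖Y₂‖) := by
          gcongr
          refine (norm_mul_le _ _).trans ?_
          gcongr
          refine (norm_mul_le _ _).trans ?_
          gcongr
          exact norm_mul_le _ _
      _ ≤ ρ ^ 2 * (1 / ρ * ‖N₁‖ * m * (M / (ρ ^ 2 * (1 + g)))) := by gcongr
      _ = _ := by field_simp
  have p2 : ‖ρ ^ 2 • (Y₁ * S₁⁻¹ * N₂ * (s₂⁻¹ * b))‖ ≤ m * M / (ρ * (1 + g)) * ‖N₂‖ := by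
    rw [norm_smul, Real.norm_of_nonneg (by positivity)]
    calc ρ ^ 2 * ‖Y₁ * S₁⁻¹ * N₂ * (s₂⁻¹ * b)‖
        ≤ ρ ^ 2 * (‖Y₁‖ * ‖S₁⁻¹‖ * ‖N₂‖ * ‖s₂⁻¹ * b‖) := by
          gcongr
          refine (norm_mul_le _ _).trans ?_
          gcongr
          refine (norm_mul_le _ _).trans ?_
          gcongr
          exact norm_mul_le _ _
      _ ≤ ρ ^ 2 * (M / (ρ ^ 2 * (1 + g)) * m * ‖N₂‖ * (1 / ρ)) := by gcongr
      _ = _ := by field_simp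
  refine mul_le_mul_of_nonneg_left ?_ (by positivity)
  rw [mul_add]
  exact add_le_add p1 p2

/-- Both `1` and `N = B^{-1/2} S B^{-1/2}` are bounded below by `1 / (m M)`, the former because `1 ≤
m * M`. -/
lemma norm_inv_sqrt_one_add_le {S B : Matrix (Fin d) (Fin d) ℝ} {M m g : ℝ} (hS : S.PosDef)
    (hB : B.PosDef) (hg : 0 ≤ g) (hmM : 1 ≤ m * M) (hm0 : 0 < m) (hM : 0 < M) (hBM : ‖B‖ ≤ M)
    (hm : ‖S⁻¹‖ ≤ m) :
    ‖(CFC.sqrt (1 + g • ((CFC.sqrt B)⁻¹ * S * (CFC.sqrt B)⁻¹)))⁻¹‖ ≤ √(m * M / (1 + g)) := by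
  have hc := posDef_sqrt hB
  set c := CFC.sqrt B
  have hA := posDef_one_add_smul (posDef_conj_inv_sqrt hB hS) hg
  refine norm_inv_sqrt_le hA ?_
  have h := norm_inv_le_of_le_inner hA (c := (1 + g) / (m * M)) (by positivity) fun x => ?_
  · rwa [one_div_div] at h
  have h1 := norm_sq_le_of_norm_inv_le hS hm (mulE c⁻¹ x)
  have h2 : ‖x‖ ^ 2 ≤ M * ‖mulE c⁻¹ x‖ ^ 2 := by
    have hx : x = mulE c (mulE c⁻¹ x) := by rw [mulE_mulE, posDef_mul_inv hc, mulE_one]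
    have h3 : ‖x‖ ≤ √M * ‖mulE c⁻¹ x‖ := by
      conv_lhs => rw [hx]
      exact (norm_mulE_le _ _).trans (by gcongr; exact norm_sqrt_le hB hBM)
    calc ‖x‖ ^ 2 ≤ (√M * ‖mulE c⁻¹ x‖) ^ 2 := by gcongr
      _ = _ := by rw [mul_pow, Real.sq_sqrt hM.le]
  have h4 : inner ℝ x (mulE (c⁻¹ * S * c⁻¹) x) = inner ℝ (mulE c⁻¹ x) (mulE S (mulE c⁻¹ x)) := by
    rw [mul_assoc, ← mulE_mulE, inner_mulE_symm hc.inv.isHermitian, mulE_mulE]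
  rw [add_mulE, mulE_one, smul_mulE, inner_add_right, inner_smul_right, h4,
    real_inner_self_eq_norm_sq, div_mul_eq_mul_div, div_le_iff₀ (by positivity)]
  have h5 : ‖x‖ ^ 2 ≤ M * (m * inner ℝ (mulE c⁻¹ x) (mulE S (mulE c⁻¹ x))) :=
    h2.trans (by gcongr)
  calc (1 + g) * ‖x‖ ^ 2 = 1 * ‖x‖ ^ 2 + g * ‖x‖ ^ 2 := by ring
    _ ≤ (m * M) * ‖x‖ ^ 2 +
        g * (M * (m * inner ℝ (mulE c⁻¹ x) (mulE S (mulE c⁻¹ x)))) := by gcongr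
    _ = _ := by ring

lemma norm_mean_sub_le {S₁ S₂ B N₁ N₂ : Matrix (Fin d) (Fin d) ℝ} {M m R g : ℝ}
    {e₁ e₂ e₁' e₂' : E d}
    (hS₁ : S₁.PosDef) (hS₂ : S₂.PosDef) (hB : B.PosDef) (hg : 0 ≤ g) (hmM : 1 ≤ m * M)
    (hm0 : 0 < m) (hM : 0 < M) (hSM₁ : ‖S₁‖ ≤ M) (hSM₂ : ‖S₂‖ ≤ M) (hBM : ‖B‖ ≤ M)
    (hm₁ : ‖S₁⁻¹‖ ≤ m) (hm₂ : ‖S₂⁻¹‖ ≤ m) (hBm : ‖B⁻¹‖ ≤ m) (hR : ‖e₁‖ ≤ R)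
    (he₁ : mulE (CFC.sqrt (1 + g • ((CFC.sqrt B)⁻¹ * S₁ * (CFC.sqrt B)⁻¹)))
      (mulE (CFC.sqrt B)⁻¹ e₁') = mulE (CFC.sqrt B)⁻¹ e₁)
    (he₂ : mulE (CFC.sqrt (1 + g • ((CFC.sqrt B)⁻¹ * S₂ * (CFC.sqrt B)⁻¹)))
      (mulE (CFC.sqrt B)⁻¹ e₂') = mulE (CFC.sqrt B)⁻¹ e₂)
    (hN : S₁ - S₂ = CFC.sqrt S₁ * N₁ + N₂ * CFC.sqrt S₂) :
    ‖e₁' - e₂'‖ ≤ m * M * (1 / √(1 + g)) * ‖e₁ - e₂‖ +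
      (d : ℝ) ^ 2 * (m ^ 3 * M ^ 2 * √M * R * (1 / √(1 + g)) * (‖N₁‖ + ‖N₂‖)) := by
  have hr₁ := norm_inv_sqrt_one_add_le hS₁ hB hg hmM hm0 hM hBM hm₁
  have hr₂ := norm_inv_sqrt_one_add_le hS₂ hB hg hmM hm0 hM hBM hm₂
  have hc := posDef_sqrt hB
  have hcM := norm_sqrt_le hB hBM
  have hcm := norm_inv_sqrt_le hB hBm
  have hK₁ := posDef_one_add_smul (posDef_conj_inv_sqrt hB hS₁) hg
  have hK₂ := posDef_one_add_smul (posDef_conj_inv_sqrt hB hS₂) hg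
  have hRR₁ := sqrt_mul_sqrt hK₁
  have hRR₂ := sqrt_mul_sqrt hK₂
  have hR₁ := posDef_sqrt hK₁
  have hR₂ := posDef_sqrt hK₂
  set R₁ := CFC.sqrt (1 + g • ((CFC.sqrt B)⁻¹ * S₁ * (CFC.sqrt B)⁻¹))
  set R₂ := CFC.sqrt (1 + g • ((CFC.sqrt B)⁻¹ * S₂ * (CFC.sqrt B)⁻¹))
  set c := CFC.sqrt B
  have hR0 : 0 ≤ R := (norm_nonneg _).trans hR
  set r := √(m * M / (1 + g)) with hr
  have hSS : ‖S₁ - S₂‖ ≤ √M * (‖N₁‖ + ‖N₂‖) := by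
    rw [hN]
    calc ‖CFC.sqrt S₁ * N₁ + N₂ * CFC.sqrt S₂‖
        ≤ ‖CFC.sqrt S₁‖ * ‖N₁‖ + ‖N₂‖ * ‖CFC.sqrt S₂‖ :=
          (norm_add_le _ _).trans (add_le_add (norm_mul_le _ _) (norm_mul_le _ _))
      _ ≤ √M * ‖N₁‖ + ‖N₂‖ * √M := by
          gcongr
          · exact norm_sqrt_le hS₁ hSM₁
          · exact norm_sqrt_le hS₂ hSM₂
      _ = _ := by ring
  have hRsub : ‖R₁ - R₂‖ ≤ (d : ℝ) ^ 2 * (r * (g * (m * (√M * (‖N₁‖ + ‖N₂‖))))) := by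
    -- The Sylvester estimate is applied with `P' = 0`; the factor `R₁⁻¹` inside `P` contributes one
    -- power of `r`.
    have key : R₁ * (R₁ - R₂) + (R₁ - R₂) * R₂ =
        R₁ * (R₁⁻¹ * (g • (c⁻¹ * (S₁ - S₂) * c⁻¹))) + 0 * R₂ := by
      rw [← mul_assoc, posDef_mul_inv hR₁, one_mul, zero_mul, add_zero]
      have h1 : R₁ * (R₁ - R₂) + (R₁ - R₂) * R₂ = R₁ * R₁ - R₂ * R₂ := by noncomm_ring
      rw [h1, hRR₁, hRR₂, mul_sub, sub_mul]
      module
    refine (norm_le_of_sylvester hR₁ hR₂ key).trans ?_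
    rw [norm_zero, add_zero]
    gcongr
    calc ‖R₁⁻¹ * (g • (c⁻¹ * (S₁ - S₂) * c⁻¹))‖
        ≤ ‖R₁⁻¹‖ * (g * (‖c⁻¹‖ * ‖S₁ - S₂‖ * ‖c⁻¹‖)) := by
          refine (norm_mul_le _ _).trans ?_
          rw [norm_smul, Real.norm_of_nonneg hg]
          gcongr
          refine (norm_mul_le _ _).trans ?_
          gcongr
          exact norm_mul_le _ _
      _ ≤ r * (g * (√m * (√M * (‖N₁‖ + ‖N₂‖)) * √m)) := by gcongr
      _ = r * (g * (√m ^ 2 * (√M * (‖N₁‖ + ‖N₂‖)))) := by ring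
      _ = _ := by rw [Real.sq_sqrt hm0.le]
  have inv₁ : mulE c⁻¹ e₁' = mulE R₁⁻¹ (mulE c⁻¹ e₁) := by
    rw [← he₁, mulE_mulE R₁⁻¹, posDef_inv_mul hR₁, mulE_one]
  have inv₂ : mulE c⁻¹ e₂' = mulE R₂⁻¹ (mulE c⁻¹ e₂) := by
    rw [← he₂, mulE_mulE R₂⁻¹, posDef_inv_mul hR₂, mulE_one]
  -- In this form of the resolvent identity the difference `R₁ - R₂` acts only on `e₁`, so a bound
  -- on the first initial mean is enough.
  have e : e₁' - e₂' = mulE c (mulE R₂⁻¹ (mulE c⁻¹ (e₁ - e₂) -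
      mulE (R₁ - R₂) (mulE R₁⁻¹ (mulE c⁻¹ e₁)))) := by
    have h1 : e₁' - e₂' = mulE c (mulE c⁻¹ e₁' - mulE c⁻¹ e₂') := by
      rw [← mulE_sub, mulE_mulE, posDef_mul_inv hc, mulE_one]
    rw [h1]
    congr 1
    rw [sub_mulE, mulE_mulE R₁ R₁⁻¹, posDef_mul_inv hR₁, mulE_one, mulE_sub c⁻¹, mulE_sub R₂⁻¹,
      mulE_sub R₂⁻¹, mulE_sub R₂⁻¹, mulE_mulE R₂⁻¹ R₂, posDef_inv_mul hR₂, mulE_one, ← inv₁,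
      ← inv₂]
    abel
  have step : ‖e₁' - e₂'‖ ≤ √M * (r * (√m * ‖e₁ - e₂‖ +
      (d : ℝ) ^ 2 * (r * (g * (m * (√M * (‖N₁‖ + ‖N₂‖))))) * (r * (√m * R)))) := by
    rw [e]
    refine (norm_mulE_le _ _).trans ?_
    gcongr
    refine (norm_mulE_le _ _).trans ?_
    gcongr
    refine (norm_sub_le _ _).trans ?_
    gcongr
    · exact (norm_mulE_le _ _).trans (by gcongr)
    · refine (norm_mulE_le _ _).trans ?_
      gcongr
      refine (norm_mulE_le _ _).trans ?_
      gcongr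
      exact (norm_mulE_le _ _).trans (by gcongr)
  refine step.trans ?_
  have hr1 : r = √m * √M * (1 / √(1 + g)) := by
    rw [hr, Real.sqrt_div (by positivity), Real.sqrt_mul hm0.le]; ring
  have hm2 : √m ^ 2 = m := Real.sq_sqrt hm0.le
  have hM2 : √M ^ 2 = M := Real.sq_sqrt hM.le
  -- Of the three factors `r` in the second term, two absorb the growing `g`; the third keeps the
  -- decay.
  have hq : (1 / √(1 + g)) ^ 2 * g ≤ 1 := by
    rw [div_pow, Real.sq_sqrt (by positivity), one_pow, div_mul_eq_mul_div, one_mul,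
      div_le_one (by positivity)]
    linarith
  have hq0 : 0 ≤ 1 / √(1 + g) := by positivity
  rw [hr1]
  generalize 1 / √(1 + g) = q at *
  generalize √m = p at *
  calc _ = p ^ 2 * √M ^ 2 * q * ‖e₁ - e₂‖ +
        (d : ℝ) ^ 2 * ((p ^ 2) ^ 2 * m * (√M ^ 2) ^ 2 * √M * R * q * (‖N₁‖ + ‖N₂‖) *
          (q ^ 2 * g)) := by ring
    _ ≤ p ^ 2 * √M ^ 2 * q * ‖e₁ - e₂‖ +
        (d : ℝ) ^ 2 * ((p ^ 2) ^ 2 * m * (√M ^ 2) ^ 2 * √M * R * q * (‖N₁‖ + ‖N₂‖) * 1) := by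
        gcongr
    _ = _ := by rw [hm2, hM2]; ring

/-! ### The stability estimate in the Wasserstein distance -/

/-- `W₂` is a root of an infimum, so the bound is squared before passing to the infimum over
couplings; dividing by `K` in `ℝ≥0∞` needs it nonzero and finite. -/
lemma le_mul_W₂ {ν₁ ν₂ : Measure (E d)} {L K : ℝ≥0∞} (hK : K ≠ 0) (hK' : K ≠ ⊤)
    (h : ∀ π, IsCoupling π ν₁ ν₂ → L ≤ K * (∫⁻ p, edist p.1 p.2 ^ 2 ∂π) ^ (1 / 2 : ℝ)) :
    L ≤ K * W₂ ν₁ ν₂ := by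
  have h1 : (L / K) ^ (2 : ℝ) ≤
      ⨅ (π : Measure (E d × E d)) (_ : IsCoupling π ν₁ ν₂), ∫⁻ p, edist p.1 p.2 ^ 2 ∂π := by
    refine le_iInf₂ fun π hπ => ?_
    have h2 : L / K ≤ (∫⁻ p, edist p.1 p.2 ^ 2 ∂π) ^ (1 / 2 : ℝ) := by
      refine ENNReal.div_le_of_le_mul ?_
      rw [mul_comm]
      exact h π hπ
    calc (L / K) ^ (2 : ℝ) ≤ ((∫⁻ p, edist p.1 p.2 ^ 2 ∂π) ^ (1 / 2 : ℝ)) ^ (2 : ℝ) := by gcongr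
      _ = _ := by rw [← ENNReal.rpow_mul]; norm_num
  have h3 : L / K ≤ W₂ ν₁ ν₂ := by
    calc L / K = ((L / K) ^ (2 : ℝ)) ^ (1 / 2 : ℝ) := by rw [← ENNReal.rpow_mul]; norm_num
      _ ≤ _ := by unfold W₂; gcongr
  rw [mul_comm]
  exact (ENNReal.div_le_iff hK hK').1 h3

lemma IsGaussian.exists_param {f : ℝ → E d → ℝ} (hf : IsGaussian f) :
    ∃ (μ : ℝ → E d) (S : ℝ → Matrix (Fin d) (Fin d) ℝ),
      (∀ t, 0 ≤ t → (S t).PosDef) ∧ ∀ t, 0 ≤ t → f t = gaussianDensity (μ t) (S t) := by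
  choose! μ S h using hf
  exact ⟨μ, S, fun t ht => (h t ht).1, fun t ht => (h t ht).2⟩

/-! ### Decay rates and assembly of the estimates -/

/-- The decay factor of the stability estimate. -/
def decay (σ t : ℝ) : ℝ := Real.exp (-σ * t) / √(alpha σ t) ^ (1 + ⌊min 1 σ⌋₊)

lemma exp_sq_le_one {σ t : ℝ} (hσ : 0 ≤ σ) (ht : 0 ≤ t) : Real.exp (-σ * t) ^ 2 ≤ 1 := by
  have : Real.exp (-σ * t) ≤ 1 := Real.exp_le_one_iff.2 (by nlinarith)
  exact pow_le_one₀ (Real.exp_pos _).le this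

lemma alpha_pos {σ t : ℝ} (hσ : 0 ≤ σ) (ht : 0 ≤ t) : 0 < alpha σ t := by
  rw [alpha_eq]
  have := timeChange_nonneg hσ ht
  positivity

lemma decay_pos {σ t : ℝ} (hσ : 0 ≤ σ) (ht : 0 ≤ t) : 0 < decay σ t := by
  have := alpha_pos hσ ht
  unfold decay
  positivity

lemma alpha_eq_of_ne_zero {σ t : ℝ} (hσ : σ ≠ 0) :
    alpha σ t = (1 / σ) * (1 - Real.exp (-σ * t) ^ 2) + Real.exp (-σ * t) ^ 2 := by
  have h1 : Real.exp (-σ * t) ^ 2 = Real.exp (-2 * σ * t) := by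
    rw [← Real.exp_nat_mul]; congr 1; push_cast; ring
  rw [alpha, if_neg hσ, h1]

/-- For `σ > 0`, `alpha σ t` is a convex combination of `1 / σ` and `1`; `alpha_le_one` rests on the
same fact. -/
lemma one_le_alpha {σ t : ℝ} (hσ : 0 ≤ σ) (hσ' : σ < 1) (ht : 0 ≤ t) : 1 ≤ alpha σ t := by
  rcases hσ.eq_or_lt with rfl | h
  · simp [alpha]; linarith
  · rw [alpha_eq_of_ne_zero h.ne']
    have h1 := exp_sq_le_one hσ ht
    have h2 : 1 ≤ 1 / σ := by rw [le_div_iff₀ h]; linarith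
    nlinarith

lemma alpha_le_one {σ t : ℝ} (hσ : 1 ≤ σ) (ht : 0 ≤ t) : alpha σ t ≤ 1 := by
  have h : 0 < σ := by linarith
  rw [alpha_eq_of_ne_zero h.ne']
  have h1 := exp_sq_le_one h.le ht
  have h2 : 1 / σ ≤ 1 := by rw [div_le_iff₀ h]; linarith
  nlinarith

lemma floor_min_eq_zero {σ : ℝ} (hσ' : σ < 1) : ⌊min 1 σ⌋₊ = 0 :=
  Nat.floor_eq_zero.2 (lt_of_le_of_lt (min_le_right _ _) hσ')

lemma floor_min_eq_one {σ : ℝ} (hσ : 1 ≤ σ) : ⌊min 1 σ⌋₊ = 1 := by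
  rw [min_eq_left hσ, Nat.floor_one]

/-- The left side is the rate of the covariances, and that of `exp_div_sqrt_alpha_le_decay` the rate
of the means. `decay` equals the former for `σ ≥ 1` and the latter for `σ < 1`. -/
lemma exp_div_alpha_le_decay {σ t : ℝ} (hσ : 0 ≤ σ) (ht : 0 ≤ t) :
    Real.exp (-σ * t) / alpha σ t ≤ decay σ t := by
  have ha := alpha_pos hσ ht
  have hs : √(alpha σ t) * √(alpha σ t) = alpha σ t := Real.mul_self_sqrt ha.le
  have hs0 := Real.sqrt_pos.2 ha
  unfold decay
  rcases lt_or_ge σ 1 with h | h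
  · rw [floor_min_eq_zero h, add_zero, pow_one]
    gcongr
    have := one_le_alpha hσ h ht
    have : 1 ≤ √(alpha σ t) := Real.one_le_sqrt.2 this
    nlinarith
  · rw [floor_min_eq_one h, one_add_one_eq_two, sq, hs]

lemma exp_div_sqrt_alpha_le_decay {σ t : ℝ} (hσ : 0 ≤ σ) (ht : 0 ≤ t) :
    Real.exp (-σ * t) / √(alpha σ t) ≤ decay σ t := by
  have ha := alpha_pos hσ ht
  have hs0 := Real.sqrt_pos.2 ha
  unfold decay
  rcases lt_or_ge σ 1 with h | h
  · rw [floor_min_eq_zero h, add_zero, pow_one]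
  · rw [floor_min_eq_one h, one_add_one_eq_two]
    gcongr
    have : √(alpha σ t) ≤ 1 := Real.sqrt_le_one.2 (alpha_le_one h ht)
    nlinarith

lemma one_le_norm_inv_mul_norm (hd : 0 < d) {A : Matrix (Fin d) (Fin d) ℝ} (hA : A.PosDef) :
    1 ≤ ‖A⁻¹‖ * ‖A‖ := by
  have : Nonempty (Fin d) := ⟨⟨0, hd⟩⟩
  have : Nontrivial (Matrix (Fin d) (Fin d) ℝ) := inferInstance
  have h1 : ‖(1 : Matrix (Fin d) (Fin d) ℝ)‖ = 1 := CStarRing.norm_one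
  rw [← h1, ← posDef_inv_mul hA]
  exact norm_mul_le _ _

/-- The constant of the stability estimate. -/
def stabilityConst (d : ℕ) : ℝ := gaussConst d * (1 + 4 * (d : ℝ) ^ 4)

lemma stabilityConst_pos (d : ℕ) : 0 < stabilityConst d := by
  have := gaussConst_pos d
  unfold stabilityConst
  positivity

lemma rpow_seven_halves {M : ℝ} (hM : 0 ≤ M) : M ^ (7 / 2 : ℝ) = M ^ 3 * √M := by
  rw [Real.sqrt_eq_rpow, ← Real.rpow_natCast, ← Real.rpow_add_of_nonneg hM (by norm_num)
    (by norm_num)]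
  norm_num

/-- Stability of the parameters of two Gaussian solutions. -/
lemma norm_mean_sub_add_norm_sqrt_sub_le {P : InverseProblem d k} {σ : ℝ} (hσ : 0 ≤ σ)
    {f₁ f₂ : ℝ → E d → ℝ} (hf₁ : IsSolution P σ f₁) (hf₂ : IsSolution P σ f₂)
    {μ₁ μ₂ : ℝ → E d} {S₁ S₂ : ℝ → Matrix (Fin d) (Fin d) ℝ}
    (hS₁ : ∀ t, 0 ≤ t → (S₁ t).PosDef) (hS₂ : ∀ t, 0 ≤ t → (S₂ t).PosDef)
    (hfS₁ : ∀ t, 0 ≤ t → f₁ t = gaussianDensity (μ₁ t) (S₁ t))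
    (hfS₂ : ∀ t, 0 ≤ t → f₂ t = gaussianDensity (μ₂ t) (S₂ t)) {M m R : ℝ}
    (hSM₁ : ‖S₁ 0‖ ≤ M) (hSM₂ : ‖S₂ 0‖ ≤ M) (hBM : ‖P.B‖ ≤ M)
    (hm₁ : ‖(S₁ 0)⁻¹‖ ≤ m) (hm₂ : ‖(S₂ 0)⁻¹‖ ≤ m) (hBm : ‖P.B⁻¹‖ ≤ m)
    (hR : ‖μ₁ 0 - P.u₀‖ ≤ R) {N₁ N₂ : Matrix (Fin d) (Fin d) ℝ}
    (hN : S₁ 0 - S₂ 0 = CFC.sqrt (S₁ 0) * N₁ + N₂ * CFC.sqrt (S₂ 0)) {D : ℝ}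
    (hD : 0 ≤ D) (hμ : ‖μ₁ 0 - μ₂ 0‖ ≤ D) (hN₁ : ‖N₁‖ ≤ (d : ℝ) ^ 2 * D)
    (hN₂ : ‖N₂‖ ≤ (d : ℝ) ^ 2 * D) {t : ℝ} (ht : 0 ≤ t) :
    ‖μ₁ t - μ₂ t‖ + ‖CFC.sqrt (S₁ t) - CFC.sqrt (S₂ t)‖ ≤
      (1 + 4 * (d : ℝ) ^ 4) * (1 + m * M + m ^ 4 * M ^ (7 / 2 : ℝ) * R) * decay σ t * D := by
  have hφ := decay_pos hσ ht
  have hM0 : 0 ≤ M := (norm_nonneg _).trans hBM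
  have hm0 : 0 ≤ m := (norm_nonneg _).trans hBm
  have hR0 : 0 ≤ R := (norm_nonneg _).trans hR
  -- In dimension zero the identity has norm zero and `1 ≤ m * M` may fail, but both differences
  -- vanish.
  rcases Nat.eq_zero_or_pos d with rfl | hd
  · have e1 : μ₁ t - μ₂ t = 0 := Subsingleton.elim _ _
    have e2 : CFC.sqrt (S₁ t) - CFC.sqrt (S₂ t) = 0 := Subsingleton.elim _ _
    rw [e1, e2, norm_zero, norm_zero, add_zero]
    positivity
  have hmM : 1 ≤ m * M := (one_le_norm_inv_mul_norm hd P.posDef_B).trans (by gcongr)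
  have hMpos : 0 < M := by
    rcases hM0.eq_or_lt with h | h
    · rw [← h] at hmM; norm_num at hmM
    · exact h
  have hmpos : 0 < m := by
    rcases hm0.eq_or_lt with h | h
    · rw [← h] at hmM; norm_num at hmM
    · exact h
  have hg := timeChange_nonneg hσ ht
  have hρ := Real.exp_pos (-σ * t)
  have hα := alpha_eq σ t
  have h1 := norm_sqrt_sub_sqrt_le (hS₁ 0 le_rfl) (hS₂ 0 le_rfl) P.posDef_B (hS₁ t ht) (hS₂ t ht)
    hρ hg hMpos (hf₁.inv_cov_eq hS₁ hfS₁ ht) (hf₂.inv_cov_eq hS₂ hfS₂ ht) hSM₁ hSM₂ hBM hm₁ hm₂ hN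
  have h2 := norm_mean_sub_le (hS₁ 0 le_rfl) (hS₂ 0 le_rfl) P.posDef_B hg hmM hmpos hMpos
    hSM₁ hSM₂ hBM hm₁ hm₂ hBm hR (hf₁.mean_eq hσ hS₁ hfS₁ ht) (hf₂.mean_eq hσ hS₂ hfS₂ ht) hN
  rw [sub_sub_sub_cancel_right, sub_sub_sub_cancel_right] at h2
  have d1 : 1 / (Real.exp (-σ * t) * (1 + timeChange σ t)) ≤ decay σ t := by
    refine le_trans (le_of_eq ?_) (exp_div_alpha_le_decay hσ ht)
    rw [hα]
    field_simp
  have d2 : 1 / √(1 + timeChange σ t) ≤ decay σ t := by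
    refine le_trans (le_of_eq ?_) (exp_div_sqrt_alpha_le_decay hσ ht)
    rw [hα, Real.sqrt_mul (by positivity), Real.sqrt_sq hρ.le]
    field_simp
  have hNN : ‖N₁‖ + ‖N₂‖ ≤ 2 * (d : ℝ) ^ 2 * D := by linarith
  set φ := decay σ t
  have h1' : ‖CFC.sqrt (S₁ t) - CFC.sqrt (S₂ t)‖ ≤
      (d : ℝ) ^ 2 * (m * M * φ * (2 * (d : ℝ) ^ 2 * D)) := by
    refine h1.trans ?_
    rw [div_eq_mul_one_div (m * M)]
    gcongr
  have h2' : ‖μ₁ t - μ₂ t‖ ≤ m * M * φ * D +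
      (d : ℝ) ^ 2 * (m ^ 3 * M ^ 2 * √M * R * φ * (2 * (d : ℝ) ^ 2 * D)) := by
    refine h2.trans ?_
    gcongr
  -- One spare factor `m * M ≥ 1` brings the powers to those of the statement.
  have h3 : m ^ 3 * M ^ 2 * √M * R ≤ m ^ 4 * M ^ (7 / 2 : ℝ) * R := by
    rw [rpow_seven_halves hM0]
    calc m ^ 3 * M ^ 2 * √M * R = 1 * (m ^ 3 * M ^ 2 * √M * R) := by ring
      _ ≤ (m * M) * (m ^ 3 * M ^ 2 * √M * R) := by gcongr
      _ = _ := by ring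
  have h4 : 0 ≤ m ^ 4 * M ^ (7 / 2 : ℝ) * R := by positivity
  have h5 : 0 ≤ φ * D := by positivity
  have h6 : 0 ≤ (d : ℝ) ^ 4 := by positivity
  generalize m ^ 4 * M ^ (7 / 2 : ℝ) * R = Z at *
  have h7 : m ^ 3 * M ^ 2 * √M * R * ((d : ℝ) ^ 4 * (φ * D)) ≤ Z * ((d : ℝ) ^ 4 * (φ * D)) := by
    gcongr
  generalize m ^ 3 * M ^ 2 * √M * R = Z' at *
  generalize m * M = q at *
  have p1 : 0 ≤ (d : ℝ) ^ 4 * (φ * D) := by positivity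
  have p2 : 0 ≤ q * ((d : ℝ) ^ 4 * (φ * D)) := by positivity
  have p3 : 0 ≤ Z * ((d : ℝ) ^ 4 * (φ * D)) := by positivity
  have p4 : 0 ≤ Z * (φ * D) := by positivity
  -- The covariances and the second part of the means each contribute `2 d ^ 4`; the first part of
  -- the means accounts for the `1` in `1 + 4 d ^ 4`.
  nlinarith

end MeanField

end

theorem mainTheorem3 (d : ℕ) :
    ∃ C : ℝ, 0 < C ∧
      ∀ (K : ℕ) (P : MeanField.InverseProblem d K) (σ : ℝ), 0 ≤ σ →
      ∀ f₁ f₂ : ℝ → MeanField.E d → ℝ,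
        MeanField.IsSolution P σ f₁ → MeanField.IsSolution P σ f₂ →
        MeanField.IsGaussian f₁ → MeanField.IsGaussian f₂ →
      ∀ M m R : ℝ,
        MeanField.opNorm (MeanField.cov (f₁ 0)) ≤ M →
        MeanField.opNorm (MeanField.cov (f₂ 0)) ≤ M →
        MeanField.opNorm P.B ≤ M →
        MeanField.opNorm (MeanField.cov (f₁ 0))⁻¹ ≤ m →
        MeanField.opNorm (MeanField.cov (f₂ 0))⁻¹ ≤ m →
        MeanField.opNorm P.B⁻¹ ≤ m →
        ‖MeanField.mean (f₁ 0) - P.u₀‖ ≤ R →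
      ∀ t : ℝ, 0 ≤ t →
        MeanField.W₂ (MeanField.toMeasure (f₁ t)) (MeanField.toMeasure (f₂ t)) ≤
          ENNReal.ofReal
            (C * (1 + m * M + m ^ 4 * M ^ (7 / 2 : ℝ) * R) *
              (Real.exp (-σ * t) / √(MeanField.alpha σ t) ^ (1 + ⌊min 1 σ⌋₊))) *
          MeanField.W₂ (MeanField.toMeasure (f₁ 0)) (MeanField.toMeasure (f₂ 0)) := by
  refine ⟨MeanField.stabilityConst d, MeanField.stabilityConst_pos d, ?_⟩
  intro K P σ hσ f₁ f₂ hf₁ hf₂ hG₁ hG₂ M m R hM₁ hM₂ hBM hm₁ hm₂ hBm hR t ht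
  have hM0 : 0 ≤ M := (MeanField.opNorm_nonneg _).trans hBM
  have hm0 : 0 ≤ m := (MeanField.opNorm_nonneg _).trans hBm
  obtain ⟨μ₁, S₁, hS₁, hfS₁⟩ := hG₁.exists_param
  obtain ⟨μ₂, S₂, hS₂, hfS₂⟩ := hG₂.exists_param
  have h0 : (0 : ℝ) ≤ 0 := le_rfl
  rw [hfS₁ 0 h0, MeanField.cov_gaussianDensity _ (hS₁ 0 h0), MeanField.opNorm_eq_norm] at hM₁ hm₁
  rw [hfS₂ 0 h0, MeanField.cov_gaussianDensity _ (hS₂ 0 h0), MeanField.opNorm_eq_norm] at hM₂ hm₂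
  rw [hfS₁ 0 h0, MeanField.mean_gaussianDensity _ (hS₁ 0 h0)] at hR
  rw [MeanField.opNorm_eq_norm] at hBM hBm
  have hR0 : 0 ≤ R := (norm_nonneg _).trans hR
  have hC := MeanField.stabilityConst_pos d
  have hφ : 0 < Real.exp (-σ * t) / √(MeanField.alpha σ t) ^ (1 + ⌊min 1 σ⌋₊) :=
    MeanField.decay_pos hσ ht
  have hK : 0 < MeanField.stabilityConst d * (1 + m * M + m ^ 4 * M ^ (7 / 2 : ℝ) * R) *
      (Real.exp (-σ * t) / √(MeanField.alpha σ t) ^ (1 + ⌊min 1 σ⌋₊)) := by positivity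
  rw [hfS₁ t ht, hfS₂ t ht, hfS₁ 0 h0, hfS₂ 0 h0,
    MeanField.toMeasure_gaussianDensity _ (hS₁ t ht),
    MeanField.toMeasure_gaussianDensity _ (hS₂ t ht),
    MeanField.toMeasure_gaussianDensity _ (hS₁ 0 h0),
    MeanField.toMeasure_gaussianDensity _ (hS₂ 0 h0)]
  -- It suffices to compare with the cost of an arbitrary coupling of the initial data; no optimal
  -- plan is needed.
  refine MeanField.le_mul_W₂ (ENNReal.ofReal_pos.2 hK).ne' ENNReal.ofReal_ne_top fun π hπ => ?_
  obtain ⟨D, hD, hcost, hμ, N₁, N₂, hN, hN₁, hN₂⟩ := hπ.exists_cov_sub (hS₁ 0 h0) (hS₂ 0 h0)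
  rw [hcost, ENNReal.ofReal_rpow_of_nonneg (by positivity) (by norm_num), ← Real.sqrt_eq_rpow,
    Real.sqrt_sq hD, ← ENNReal.ofReal_mul hK.le]
  refine (MeanField.W₂_multivariateGaussian_le _ _ _ _).trans (ENNReal.ofReal_le_ofReal ?_)
  have h := MeanField.norm_mean_sub_add_norm_sqrt_sub_le hσ hf₁ hf₂ hS₁ hS₂ hfS₁ hfS₂ hM₁ hM₂ hBM
    hm₁ hm₂ hBm hR hN hD hμ hN₁ hN₂ ht
  refine (mul_le_mul_of_nonneg_left h (MeanField.gaussConst_pos d).le).trans (le_of_eq ?_)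
  rw [MeanField.stabilityConst, MeanField.decay]
  ring
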